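/- **Proposition 3.5 (Stokes' theorem).** Let $m\ge 1$ and let $M$ be a connected, oriented, smooth ($C^\infty$) manifold with corners of dimension $m$, i.e. a connected, second countable Hausdorff space with a smooth atlas of charts onto open subsets of the quadrant $Q^m=\{x\in\mathbb R^m: x_i\ge 0 \text{ for all } i\}$, with a continuous choice of orientations of the tangent spaces. Let $\partial^1 M$ be the set of all corners of codimension $1$, that is, of all points of $M$ that lie, in a chart, on exactly one of the coordinate hyperplanes $\{x_i=0\}$. It is a smooth manifold without boundary of dimension $m-1$ (possibly empty, disconnected or non-compact); we give it the boundary orientation (outward normal first), and we write $j_{\partial^1M}\colon\partial^1M\to M$ for the inclusion. Then for every smooth differential form $\omega\in\Omega^{m-1}_c(M)$ of degree $m-1$ with compact support in $M$, the form $d\omega$ is absolutely integrable over $M$, the form $j_{\partial^1M}^*\omega$ (whose support in $\partial^1M$ need not be compact) is absolutely integrable over $\partial^1M$, and $$\int_M d\omega=\int_{\partial^1M}j_{\partial^1M}^*\omega .$$ For $m=1$ the manifold $\partial^1M$ is discrete, its orientation is a choice of signs, and the right-hand side is the finite sum of the values of $\omega$ at the points of $\partial^1 M$, taken with these signs. 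-/

import Mathlib

open Set Filter Topology MeasureTheory
open scoped Manifold ContDiff

noncomputable section

namespace CornerStokes

/-! ### Differential forms on a manifold (possibly with boundary or corners) -/

section Forms

variable {E : Type*} [NormedAddCommGroup E] [NormedSpace ℝ E]
  {H : Type*} [TopologicalSpace H] (I : ModelWithCorners ℝ E H)
  {E' : Type*} [NormedAddCommGroup E'] [NormedSpace ℝ E']
  {H' : Type*} [TopologicalSpace H'] (I' : ModelWithCorners ℝ E' H')
  {M : Type*} [TopologicalSpace M] [ChartedSpace H M]
  {N : Type*} [TopologicalSpace N] [ChartedSpace H' N]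

variable (M) in
/-- A (not necessarily smooth) field of alternating `k`-linear forms on the tangent spaces. -/
abbrev DiffForm (k : ℕ) : Type _ := ∀ x : M, TangentSpace I x [⋀^Fin k]→L[ℝ] ℝ

/-- The differential at `y` of the inverse of the (extended) chart `e`. -/
def dChartSymm (e : OpenPartialHomeomorph M H) (y : E) :
    E →L[ℝ] TangentSpace I ((e.extend I).symm y) :=
  mfderivWithin 𝓘(ℝ, E) I (e.extend I).symm (range I) y

/-- The form `α` in the chart `e`: its pullback along the inverse of the chart.
It is meaningful on `(e.extend I).target`. -/
def chartRep {k : ℕ} (e : OpenPartialHomeomorph M H) (α : DiffForm I M k) (y : E) :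
    E [⋀^Fin k]→L[ℝ] ℝ :=
  (α ((e.extend I).symm y)).compContinuousLinearMap (dChartSymm I e y)

/-- `α` is a smooth form: it is smooth in every chart of the atlas. -/
def SmoothForm {k : ℕ} (α : DiffForm I M k) : Prop :=
  ∀ e ∈ atlas H M, ContDiffOn ℝ ∞ (chartRep I e α) (e.extend I).target

/-- The support (the closure of the set where `α` does not vanish) is compact. -/
def CompactlySupported {k : ℕ} (α : DiffForm I M k) : Prop :=
  IsCompact (closure {x : M | α x ≠ 0})

/-- The exterior derivative: at `x` it is computed in the preferred chart around `x`
(any other chart around `x` gives the same value, as `d` commutes with pullbacks). -/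
def extDer {k : ℕ} (α : DiffForm I M k) : DiffForm I M (k + 1) := fun x =>
  (extDerivWithin (chartRep I (chartAt H x) α) (range I)
    (extChartAt I x x)).compContinuousLinearMap (mfderiv I 𝓘(ℝ, E) (extChartAt I x) x)

/-- The pullback `f^* α` of a form along a smooth map `f`. -/
def pullback {k : ℕ} (f : N → M) (α : DiffForm I M k) : DiffForm I' N k := fun x =>
  (α (f x)).compContinuousLinearMap (mfderiv I' I f x)

end Forms

/-! ### Orientations and integrals of forms of top degree -/

section Integration

variable {k : ℕ} {H : Type*} [TopologicalSpace H]
  (I : ModelWithCorners ℝ (EuclideanSpace ℝ (Fin k)) H)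
  {N : Type*} [TopologicalSpace N] [ChartedSpace H N]

/-- The sign of a `k`-tuple of vectors with respect to an orientation. -/
def frameSign {V : Type*} [AddCommGroup V] [Module ℝ V] (o : Orientation ℝ V (Fin k))
    (v : Fin k → V) : SignType :=
  SignType.sign (o.someVector v)

/-- The standard basis of `ℝ^k`. -/
def stdFrame (k : ℕ) : Fin k → EuclideanSpace ℝ (Fin k) := fun i => EuclideanSpace.single i 1

variable (N) in
/-- A choice of an orientation of each tangent space. -/
abbrev PointwiseOrientation : Type _ := ∀ x : N, Orientation ℝ (TangentSpace I x) (Fin k)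

/-- The pointwise orientation `o` is an orientation of the manifold: in each chart of the atlas,
the sign of the coordinate frame is locally constant. -/
def IsOrientation (o : PointwiseOrientation I N) : Prop :=
  ∀ e ∈ atlas H N, ∀ y ∈ (e.extend I).target, ∀ᶠ z in 𝓝[(e.extend I).target] y,
    frameSign (o ((e.extend I).symm z)) (fun i => dChartSymm I e z (stdFrame k i)) =
      frameSign (o ((e.extend I).symm y)) (fun i => dChartSymm I e y (stdFrame k i))

open Classical in
/-- The sign of the form `η` of top degree at `x` relative to the orientation `o`: `0` if `η`
vanishes at `x`, `1` if `η x` is a positive multiple of the alternating forms that define `o x`,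
and `-1` if it is a negative multiple (the space of these forms is one-dimensional). -/
def formSign (o : PointwiseOrientation I N) (η : DiffForm I N k) (x : N) : ℝ :=
  if η x = 0 then 0
  else if SameRay ℝ (o x).someVector (η x).toAlternatingMap then 1 else -1

variable [MeasurableSpace N]

/-- The Borel measure on the domain of the chart `e` with density `|η|`: in the
coordinates of `e` it is `|η(∂₁, …, ∂ₖ)|` times the Lebesgue measure. -/
def chartMeasure (η : DiffForm I N k) (e : OpenPartialHomeomorph N H) : Measure N :=
  Measure.map (e.extend I).symm
    ((volume.restrict (e.extend I).target).withDensity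
      fun y => ENNReal.ofReal |chartRep I e η y (stdFrame k)|)

/-- The measure `|η|` on `N`. By the change of variables formula the measures
`chartMeasure I η e` agree on the overlaps of the charts, and their least upper bound in the
lattice of measures is the measure on `N` that restricts to each of them. -/
def formMeasure (η : DiffForm I N k) : Measure N :=
  ⨆ e ∈ atlas H N, chartMeasure I η e

/-- The form `η` of top degree is absolutely integrable. -/
def IntegrableForm (o : PointwiseOrientation I N) (η : DiffForm I N k) : Prop :=
  Integrable (formSign I o η) (formMeasure I η)

/-- The integral of the form `η` of top degree over `N` with the orientation `o`. -/
def formIntegral (o : PointwiseOrientation I N) (η : DiffForm I N k) : ℝ :=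
  ∫ x, formSign I o η x ∂(formMeasure I η)

end Integration

/-! ### Manifolds with corners and their strata -/

section Strata

/-- The model of the manifolds with corners of dimension `m`: the quadrant in `ℝ^m`. -/
abbrev QModel (m : ℕ) :
    ModelWithCorners ℝ (EuclideanSpace ℝ (Fin m)) (EuclideanQuadrant m) :=
  modelWithCornersEuclideanQuadrant m

/-- The corners of codimension `q`: the points that lie, in a chart, on exactly `q` of the
coordinate hyperplanes (`q` does not depend on the chart). -/
def stratum (m : ℕ) (M : Type*) [TopologicalSpace M] [ChartedSpace (EuclideanQuadrant m) M]
    (q : ℕ) : Set M :=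
  {x | ∃ e ∈ atlas (EuclideanQuadrant m) M, x ∈ e.source ∧
    (Finset.univ.filter fun i : Fin m => (e x).1 i = 0).card = q}

variable {n : ℕ}

/-- The inclusion of `ℝ^n` in `ℝ^(n+1)` as the hyperplane where the `i`-th coordinate is zero. -/
def faceIncl (i : Fin (n + 1)) :
    EuclideanSpace ℝ (Fin n) →L[ℝ] EuclideanSpace ℝ (Fin (n + 1)) :=
  LinearMap.toContinuousLinearMap
    { toFun := fun u => WithLp.toLp 2 (i.insertNth (0 : ℝ) (fun j => u j))
      map_add' := by
        intro u v
        ext j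
        refine Fin.succAboveCases i ?_ (fun j => ?_) j <;> simp
      map_smul' := by
        intro c u
        ext j
        refine Fin.succAboveCases i ?_ (fun j => ?_) j <;> simp }

/-- The projection of `ℝ^(n+1)` to `ℝ^n` that drops the `i`-th coordinate. -/
def faceProj (i : Fin (n + 1)) :
    EuclideanSpace ℝ (Fin (n + 1)) →L[ℝ] EuclideanSpace ℝ (Fin n) :=
  LinearMap.toContinuousLinearMap
    { toFun := fun v => WithLp.toLp 2 (fun j => v (i.succAbove j))
      map_add' := by intro u v; ext j; simp
      map_smul' := by intro c u; ext j; simp }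

@[simp] theorem faceIncl_same (i : Fin (n + 1)) (u : EuclideanSpace ℝ (Fin n)) :
    faceIncl i u i = 0 := by
  simp [faceIncl]

@[simp] theorem faceIncl_succAbove (i : Fin (n + 1)) (u : EuclideanSpace ℝ (Fin n)) (j : Fin n) :
    faceIncl i u (i.succAbove j) = u j := by
  simp [faceIncl]

@[simp] theorem faceProj_apply (i : Fin (n + 1)) (v : EuclideanSpace ℝ (Fin (n + 1))) (j : Fin n) :
    faceProj i v j = v (i.succAbove j) := by
  simp [faceProj]

theorem faceProj_faceIncl (i : Fin (n + 1)) (u : EuclideanSpace ℝ (Fin n)) :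
    faceProj i (faceIncl i u) = u := by
  ext j; simp

theorem faceIncl_faceProj (i : Fin (n + 1)) (v : EuclideanSpace ℝ (Fin (n + 1))) (h : v i = 0) :
    faceIncl i (faceProj i v) = v := by
  ext j
  refine Fin.succAboveCases i ?_ (fun j => ?_) j <;> simp [h]

variable {M : Type*} [TopologicalSpace M] [ChartedSpace (EuclideanQuadrant (n + 1)) M]

/-- `e` is a chart around `x` in which `x` lies on the `i`-th coordinate hyperplane and on
no other one. -/
structure IsFaceChart (e : OpenPartialHomeomorph M (EuclideanQuadrant (n + 1)))
    (i : Fin (n + 1)) (x : M) : Prop where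
  mem_atlas : e ∈ atlas (EuclideanQuadrant (n + 1)) M
  mem_source : x ∈ e.source
  eq_zero_iff : ∀ j, (e x).1 j = 0 ↔ j = i

theorem exists_isFaceChart {x : M} (hx : x ∈ stratum (n + 1) M 1) :
    ∃ (e : OpenPartialHomeomorph M (EuclideanQuadrant (n + 1))) (i : Fin (n + 1)),
      IsFaceChart e i x := by
  obtain ⟨e, he, hxe, hc⟩ := hx
  obtain ⟨i, hi⟩ := Finset.card_eq_one.1 hc
  refine ⟨e, i, he, hxe, fun j => ?_⟩
  have := Finset.ext_iff.1 hi j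
  simpa using this

theorem IsFaceChart.mem_stratum {e : OpenPartialHomeomorph M (EuclideanQuadrant (n + 1))}
    {i : Fin (n + 1)} {x : M} (h : IsFaceChart e i x) : x ∈ stratum (n + 1) M 1 := by
  refine ⟨e, h.mem_atlas, h.mem_source, Finset.card_eq_one.2 ⟨i, ?_⟩⟩
  ext j
  simpa using h.eq_zero_iff j

theorem range_qModel (m : ℕ) :
    range (QModel m) = {y : EuclideanSpace ℝ (Fin m) | ∀ i, 0 ≤ y i} :=
  range_euclideanQuadrant m

theorem interior_range_qModel (m : ℕ) :
    interior (range (QModel m)) = {y : EuclideanSpace ℝ (Fin m) | ∀ i, 0 < y i} := by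
  rw [range_qModel]
  exact interior_euclideanQuadrant m 2 0

/-- A corner of codimension `1` is a boundary point in every chart. -/
theorem eq_zero_of_mem_stratum [IsManifold (QModel (n + 1)) ∞ M]
    {x : M} (hx : x ∈ stratum (n + 1) M 1)
    {e : OpenPartialHomeomorph M (EuclideanQuadrant (n + 1))}
    (he : e ∈ atlas (EuclideanQuadrant (n + 1)) M) (hxe : x ∈ e.source) {i : Fin (n + 1)}
    (hi : ∀ j : Fin n, 0 < (e x).1 (i.succAbove j)) : (e x).1 i = 0 := by
  by_contra h
  obtain ⟨e', i', h'⟩ := exists_isFaceChart hx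
  have hpos : ∀ j, 0 < (e x).1 j := fun j =>
    Fin.succAboveCases i (lt_of_le_of_ne ((e x).2 i) (Ne.symm h)) hi j
  have hint : e.extend (QModel (n + 1)) x ∈ interior (e.extend (QModel (n + 1))).target := by
    refine e.mem_interior_extend_target (e.map_source hxe) ?_
    rw [interior_range_qModel]
    exact hpos
  rw [(QModel (n + 1)).mem_interior_range_iff_of_mem_atlas (n := ∞) (by simp) he h'.mem_atlas hxe
    h'.mem_source] at hint
  have h2 : e'.extend (QModel (n + 1)) x ∈ interior (range (QModel (n + 1))) :=
    interior_mono (by rw [e'.extend_target]; exact inter_subset_right) hint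
  rw [interior_range_qModel] at h2
  have h3 := h2 i'
  have h4 : (e' x).1 i' = 0 := (h'.eq_zero_iff i').2 rfl
  exact h3.ne' h4

/-- The domain in `ℝ^n` of the `i`-th face in the chart `e`. -/
def faceTarget (e : OpenPartialHomeomorph M (EuclideanQuadrant (n + 1))) (i : Fin (n + 1)) :
    Set (EuclideanSpace ℝ (Fin n)) :=
  {u | (∀ j, 0 < u j) ∧ faceIncl i u ∈ (e.extend (QModel (n + 1))).target}

theorem isFaceChart_of_mem_faceTarget {e : OpenPartialHomeomorph M (EuclideanQuadrant (n + 1))}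
    (he : e ∈ atlas (EuclideanQuadrant (n + 1)) M)
    {i : Fin (n + 1)} {u : EuclideanSpace ℝ (Fin n)} (hu : u ∈ faceTarget e i) :
    IsFaceChart e i ((e.extend (QModel (n + 1))).symm (faceIncl i u)) := by
  have hs := (e.extend (QModel (n + 1))).map_target hu.2
  have hr : (e ((e.extend (QModel (n + 1))).symm (faceIncl i u))).1 = faceIncl i u :=
    (e.extend (QModel (n + 1))).right_inv hu.2
  rw [e.extend_source] at hs
  refine ⟨he, hs, fun j => ?_⟩
  rw [hr]
  refine Fin.succAboveCases i ?_ (fun j => ?_) j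
  · simp
  · simp [(hu.1 j).ne']

variable [IsManifold (QModel (n + 1)) ∞ M]

open Classical in
/-- The chart of the stratum `∂¹M` that the chart `e` of `M` induces on its `i`-th face:
it drops the `i`-th coordinate, which vanishes there. The point `x₀` is only
used as the value of the inverse outside its domain. -/
def faceChart (e : OpenPartialHomeomorph M (EuclideanQuadrant (n + 1))) (i : Fin (n + 1))
    (x₀ : stratum (n + 1) M 1) (he : e ∈ atlas (EuclideanQuadrant (n + 1)) M) :
    OpenPartialHomeomorph (stratum (n + 1) M 1) (EuclideanSpace ℝ (Fin n)) where
  toFun y := faceProj i (e y.1).1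
  invFun u := if h : u ∈ faceTarget e i then
      ⟨(e.extend (QModel (n + 1))).symm (faceIncl i u),
        (isFaceChart_of_mem_faceTarget he h).mem_stratum⟩
    else x₀
  source := {y | y.1 ∈ e.source ∧ ∀ j : Fin n, 0 < (e y.1).1 (i.succAbove j)}
  target := faceTarget e i
  map_source' := by
    rintro y ⟨hy, hpos⟩
    refine ⟨fun j => by simpa using hpos j, ?_⟩
    rw [faceIncl_faceProj i _ (eq_zero_of_mem_stratum y.2 he hy hpos)]
    exact (e.extend (QModel (n + 1))).map_source (by rwa [e.extend_source])
  map_target' := by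
    intro u hu
    have h := isFaceChart_of_mem_faceTarget he hu
    have hr : (e ((e.extend (QModel (n + 1))).symm (faceIncl i u))).1 = faceIncl i u :=
      (e.extend (QModel (n + 1))).right_inv hu.2
    simp only [hu, dite_true]
    refine ⟨h.mem_source, fun j => ?_⟩
    simp only [hr]
    simpa using hu.1 j
  left_inv' := by
    rintro y ⟨hy, hpos⟩
    have h0 := faceIncl_faceProj i _ (eq_zero_of_mem_stratum y.2 he hy hpos)
    have hu : faceProj i (e y.1).1 ∈ faceTarget e i := by
      refine ⟨fun j => by simpa using hpos j, ?_⟩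
      rw [h0]
      exact (e.extend (QModel (n + 1))).map_source (by rwa [e.extend_source])
    simp only [hu, dite_true]
    apply Subtype.ext
    simp only [h0]
    exact (e.extend (QModel (n + 1))).left_inv (by rwa [e.extend_source])
  right_inv' := by
    intro u hu
    have hr : (e ((e.extend (QModel (n + 1))).symm (faceIncl i u))).1 = faceIncl i u :=
      (e.extend (QModel (n + 1))).right_inv hu.2
    simp only [hu, dite_true]
    rw [hr, faceProj_faceIncl]
  open_source := by
    rw [isOpen_iff_mem_nhds]
    rintro y ⟨hy, hpos⟩
    have hc : ContinuousAt (fun z : stratum (n + 1) M 1 => (e z.1).1) y :=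
      continuous_subtype_val.continuousAt.comp
        ((e.continuousAt hy).comp continuous_subtype_val.continuousAt)
    have h1 : ∀ᶠ z : stratum (n + 1) M 1 in 𝓝 y, z.1 ∈ e.source :=
      continuous_subtype_val.continuousAt (e.open_source.mem_nhds hy)
    have h2 : ∀ᶠ z : stratum (n + 1) M 1 in 𝓝 y, ∀ j : Fin n, 0 < (e z.1).1 (i.succAbove j) := by
      rw [eventually_all]
      intro j
      have hcj : ContinuousAt (fun z : stratum (n + 1) M 1 => (e z.1).1 (i.succAbove j)) y :=
        (PiLp.continuous_apply 2 _ (i.succAbove j)).continuousAt.comp hc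
      exact hcj (Ioi_mem_nhds (hpos j))
    filter_upwards [h1, h2] with z hz1 hz2 using ⟨hz1, hz2⟩
  open_target := by
    have : faceTarget e i = {u | ∀ j, 0 < u j} ∩
        (fun u => (QModel (n + 1)).symm (faceIncl i u)) ⁻¹' e.target := by
      ext u
      simp only [faceTarget, e.extend_target, mem_inter_iff, mem_preimage]
      constructor
      · rintro ⟨h1, h2, h3⟩
        exact ⟨h1, h2⟩
      · rintro ⟨h1, h2⟩
        refine ⟨h1, h2, ?_⟩
        rw [range_qModel]
        intro j
        refine Fin.succAboveCases i ?_ (fun j => ?_) j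
        · simp
        · simpa using (h1 j).le
    rw [this]
    refine IsOpen.inter ?_ (e.open_target.preimage
      ((QModel (n + 1)).continuous_symm.comp (faceIncl i).continuous))
    have : {u : EuclideanSpace ℝ (Fin n) | ∀ j, 0 < u j} = ⋂ j, {u | 0 < u j} := by
      ext; simp
    rw [this]
    exact isOpen_iInter_of_finite fun j =>
      isOpen_lt continuous_const (PiLp.continuous_apply 2 _ j)
  continuousOn_toFun := by
    refine (faceProj i).continuous.comp_continuousOn (continuous_subtype_val.comp_continuousOn ?_)
    exact e.continuousOn.comp continuous_subtype_val.continuousOn fun y hy => hy.1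
  continuousOn_invFun := by
    rw [continuousOn_iff_continuous_domRestrict]
    refine continuous_induced_rng.2 ?_
    have h : ContinuousOn (fun u => (e.extend (QModel (n + 1))).symm (faceIncl i u))
        (faceTarget e i) :=
      (e.continuousOn_extend_symm).comp (faceIncl i).continuous.continuousOn fun u hu => hu.2
    rw [continuousOn_iff_continuous_domRestrict] at h
    refine h.congr fun u => ?_
    simp

/-- The stratum `∂¹M` as a manifold of dimension `n`, with the charts that the charts of `M`
induce on their faces. -/
instance : ChartedSpace (EuclideanSpace ℝ (Fin n)) (stratum (n + 1) M 1) where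
  atlas := {c | ∃ (e : OpenPartialHomeomorph M (EuclideanQuadrant (n + 1))) (i : Fin (n + 1))
    (x₀ : stratum (n + 1) M 1) (he : e ∈ atlas (EuclideanQuadrant (n + 1)) M),
      c = faceChart e i x₀ he}
  chartAt x := faceChart (exists_isFaceChart x.2).choose (exists_isFaceChart x.2).choose_spec.choose
    x (exists_isFaceChart x.2).choose_spec.choose_spec.mem_atlas
  mem_chart_source x := by
    have h := (exists_isFaceChart x.2).choose_spec.choose_spec
    refine ⟨h.mem_source, fun j => lt_of_le_of_ne ((_ : EuclideanQuadrant (n + 1)).2 _) fun h0 => ?_⟩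
    exact Fin.succAbove_ne _ _ ((h.eq_zero_iff _).1 h0.symm)
  chart_mem_atlas x := ⟨_, _, _, _, rfl⟩

theorem faceChart_mem_atlas (e : OpenPartialHomeomorph M (EuclideanQuadrant (n + 1)))
    (i : Fin (n + 1)) (x₀ : stratum (n + 1) M 1)
    (he : e ∈ atlas (EuclideanQuadrant (n + 1)) M) :
    faceChart e i x₀ he ∈ atlas (EuclideanSpace ℝ (Fin n)) (stratum (n + 1) M 1) :=
  ⟨e, i, x₀, he, rfl⟩

theorem faceChart_symm_val (e : OpenPartialHomeomorph M (EuclideanQuadrant (n + 1)))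
    (i : Fin (n + 1)) (x₀ : stratum (n + 1) M 1)
    (he : e ∈ atlas (EuclideanQuadrant (n + 1)) M) {u : EuclideanSpace ℝ (Fin n)}
    (hu : u ∈ faceTarget e i) :
    ((faceChart e i x₀ he).symm u).1 = (e.extend (QModel (n + 1))).symm (faceIncl i u) := by
  have : (faceChart e i x₀ he).symm u = ⟨(e.extend (QModel (n + 1))).symm (faceIncl i u),
      (isFaceChart_of_mem_faceTarget he hu).mem_stratum⟩ := dif_pos hu
  rw [this]

/-- The stratum `∂¹M` is a smooth manifold without boundary. -/
instance : IsManifold (𝓡 n) ∞ (stratum (n + 1) M 1) := by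
  refine isManifold_of_contDiffOn _ _ _ ?_
  rintro _ _ ⟨e, i, x₀, he, rfl⟩ ⟨e', i', x₀', he', rfl⟩
  have h1 := (QModel (n + 1)).contDiffOn_extendCoordChange (n := ∞)
    (IsManifold.subset_maximalAtlas (I := QModel (n + 1)) he)
    (IsManifold.subset_maximalAtlas (I := QModel (n + 1)) he')
  have hmem : ∀ u ∈ ((𝓡 n).symm ⁻¹' ((faceChart e i x₀ he).symm ≫ₕ
      (faceChart e' i' x₀' he')).source ∩ range (𝓡 n)),
      u ∈ faceTarget e i ∧ (e.extend (QModel (n + 1))).symm (faceIncl i u) ∈ e'.source := by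
    rintro u ⟨hu, -⟩
    have hu1 : u ∈ faceTarget e i := hu.1
    have hu2 : ((faceChart e i x₀ he).symm u).1 ∈ e'.source := hu.2.1
    rw [faceChart_symm_val e i x₀ he hu1] at hu2
    exact ⟨hu1, hu2⟩
  refine ((faceProj i').contDiff.comp_contDiffOn
    (h1.comp (faceIncl i).contDiff.contDiffOn fun u hu => ?_)).congr fun u hu => ?_
  · obtain ⟨hu1, hu2⟩ := hmem u hu
    exact ⟨hu1.2, by simpa [e'.extend_source] using hu2⟩
  · obtain ⟨hu1, hu2⟩ := hmem u hu
    change faceProj i' (e' ((faceChart e i x₀ he).symm u).1).1 = _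
    rw [faceChart_symm_val e i x₀ he hu1]
    rfl

/-- The inclusion of the stratum `∂¹M` in `M`. -/
def incl (n : ℕ) (M : Type*) [TopologicalSpace M]
    [ChartedSpace (EuclideanQuadrant (n + 1)) M] (x : stratum (n + 1) M 1) : M := x.1

theorem IsFaceChart.mem_faceChart_source
    {e : OpenPartialHomeomorph M (EuclideanQuadrant (n + 1))} {i : Fin (n + 1)}
    {x : stratum (n + 1) M 1} (h : IsFaceChart e i x.1) :
    x ∈ (faceChart e i x h.mem_atlas).source :=
  ⟨h.mem_source, fun _ => lt_of_le_of_ne ((e x.1).2 _) fun h0 =>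
    Fin.succAbove_ne _ _ ((h.eq_zero_iff _).1 h0.symm)⟩

theorem contMDiff_incl : ContMDiff (𝓡 n) (QModel (n + 1)) ∞ (incl n M) := by
  intro x
  obtain ⟨e, i, h⟩ := exists_isFaceChart x.2
  set c := faceChart e i x h.mem_atlas with hc
  have hx : x ∈ c.source := h.mem_faceChart_source
  have hcx : c x ∈ faceTarget e i := c.map_source hx
  have h1 : ContMDiffAt (𝓡 n) (𝓡 n) ∞ c x :=
    contMDiffAt_of_mem_maximalAtlas
      (IsManifold.subset_maximalAtlas (faceChart_mem_atlas e i x h.mem_atlas)) hx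
  have h2 : ContMDiffWithinAt 𝓘(ℝ, EuclideanSpace ℝ (Fin (n + 1))) (QModel (n + 1)) ∞
      (e.extend (QModel (n + 1))).symm ((QModel (n + 1)) '' e.target) (faceIncl i (c x)) := by
    refine contMDiffOn_extend_symm (IsManifold.subset_maximalAtlas h.mem_atlas) _ ?_
    rw [← e.extend_target' (I := QModel (n + 1))]
    exact hcx.2
  have h3 : ContMDiffAt (𝓡 n) 𝓘(ℝ, EuclideanSpace ℝ (Fin (n + 1))) ∞
      (fun y => faceIncl i (c y)) x :=
    ((faceIncl i).contMDiff.contMDiffAt (x := c x)).comp x h1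
  have h4 : ContMDiffWithinAt (𝓡 n) (QModel (n + 1)) ∞
      (fun y => (e.extend (QModel (n + 1))).symm (faceIncl i (c y))) c.source x := by
    refine ContMDiffWithinAt.comp x h2 h3.contMDiffWithinAt fun y hy => ?_
    rw [← e.extend_target' (I := QModel (n + 1))]
    exact (c.map_source hy).2
  refine (h4.contMDiffAt (c.open_source.mem_nhds hx)).congr_of_eventuallyEq ?_
  filter_upwards [c.open_source.mem_nhds hx] with y hy
  have := faceChart_symm_val e i x h.mem_atlas (c.map_source hy)
  rw [← hc, c.left_inv hy] at this
  exact this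

end Strata

/-! ### The orientation of `∂¹M` as the boundary of `M` -/

section BoundaryOrientation

/-- The contraction of a nonzero form `φ` of top degree with a vector `ν` is nonzero on a
hyperplane, the image of `L`, that does not contain `ν`. -/
theorem contraction_ne_zero {n : ℕ} {V W : Type*} [AddCommGroup V] [Module ℝ V]
    [AddCommGroup W] [Module ℝ W] (hV : Module.finrank ℝ V = n + 1) (b : Module.Basis (Fin n) ℝ W)
    {φ : V [⋀^Fin (n + 1)]→ₗ[ℝ] ℝ} (hφ : φ ≠ 0) (L : W →ₗ[ℝ] V) (hL : Function.Injective L)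
    (l : V →ₗ[ℝ] ℝ) (hl : ∀ w, l (L w) = 0) {ν : V} (hν : l ν ≠ 0) :
    (φ.curryLeft ν).compLinearMap L ≠ 0 := by
  intro h
  have hli : LinearIndependent ℝ (Fin.cons ν (L ∘ b) : Fin (n + 1) → V) := by
    rw [linearIndependent_finCons]
    refine ⟨b.linearIndependent.map' L (LinearMap.ker_eq_bot.2 hL), fun hmem => hν ?_⟩
    have hle : Submodule.span ℝ (range (L ∘ b)) ≤ LinearMap.ker l := by
      rw [Submodule.span_le]
      rintro _ ⟨j, rfl⟩
      exact hl (b j)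
    exact hle hmem
  let B := basisOfLinearIndependentOfCardEqFinrank hli (by simp [hV])
  have hB : φ B ≠ 0 := (φ.map_basis_ne_zero_iff B).2 hφ
  apply hB
  have h2 : ((φ.curryLeft ν).compLinearMap L) b = 0 := by rw [h]; rfl
  have h3 : (B : Fin (n + 1) → V) = Fin.cons ν (L ∘ b) :=
    coe_basisOfLinearIndependentOfCardEqFinrank hli _
  rw [h3]
  exact h2

variable {n : ℕ} {M : Type*} [TopologicalSpace M] [ChartedSpace (EuclideanQuadrant (n + 1)) M]

/-- The differential of the chart `e` at `x`. -/
def dChart (e : OpenPartialHomeomorph M (EuclideanQuadrant (n + 1))) (x : M) :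
    TangentSpace (QModel (n + 1)) x →L[ℝ] EuclideanSpace ℝ (Fin (n + 1)) :=
  mfderiv (QModel (n + 1)) 𝓘(ℝ, EuclideanSpace ℝ (Fin (n + 1))) (e.extend (QModel (n + 1))) x

/-- The tangent vector `v` of `M` at `x ∈ ∂¹M` points outward: in a chart that
maps `x` to the `i`-th face of the quadrant, its `i`-th coordinate is negative. -/
def IsOutward (x : stratum (n + 1) M 1)
    (v : TangentSpace (QModel (n + 1)) (incl n M x)) : Prop :=
  ∃ (e : OpenPartialHomeomorph M (EuclideanQuadrant (n + 1))) (i : Fin (n + 1)),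
    IsFaceChart e i (incl n M x) ∧ dChart e (incl n M x) v i < 0

variable [IsManifold (QModel (n + 1)) ∞ M]

theorem dChart_bijective {e : OpenPartialHomeomorph M (EuclideanQuadrant (n + 1))}
    (he : e ∈ atlas (EuclideanQuadrant (n + 1)) M) {x : M} (hx : x ∈ e.source) :
    Function.Bijective (dChart e x) := by
  have : IsManifold (QModel (n + 1)) 1 M := IsManifold.of_le (n := ∞) (by simp)
  have h1 := mdifferentiable_of_mem_atlas (I := QModel (n + 1)) he
  have h2 : HasMFDerivAt (QModel (n + 1)) 𝓘(ℝ, EuclideanSpace ℝ (Fin (n + 1)))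
      (e.extend (QModel (n + 1))) x _ :=
    ((QModel (n + 1)).hasMFDerivAt (x := e x)).comp x (h1.mdifferentiableAt hx).hasMFDerivAt
  have h3 : dChart e x = _ := h2.mfderiv
  rw [h3]
  exact h1.mfderiv_bijective hx

theorem exists_isOutward (x : stratum (n + 1) M 1) :
    ∃ v : TangentSpace (QModel (n + 1)) (incl n M x), IsOutward x v := by
  obtain ⟨e, i, h⟩ := exists_isFaceChart x.2
  obtain ⟨v, hv⟩ := (dChart_bijective h.mem_atlas h.mem_source).2 (-EuclideanSpace.single i 1)
  refine ⟨v, e, i, h, ?_⟩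
  have : dChart e (incl n M x) v = -EuclideanSpace.single i 1 := hv
  rw [this]
  simp

/-- The differential of the inclusion of `∂¹M` in `M`. -/
def dIncl (x : stratum (n + 1) M 1) :
    TangentSpace (𝓡 n) x →L[ℝ] TangentSpace (QModel (n + 1)) (incl n M x) :=
  mfderiv (𝓡 n) (QModel (n + 1)) (incl n M) x

theorem dChart_comp_dIncl {e : OpenPartialHomeomorph M (EuclideanQuadrant (n + 1))}
    {i : Fin (n + 1)} {x : stratum (n + 1) M 1} (h : IsFaceChart e i (incl n M x))
    (w : TangentSpace (𝓡 n) x) :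
    dChart e (incl n M x) (dIncl x w) =
      faceIncl i (mfderiv (𝓡 n) (𝓡 n) (faceChart e i x h.mem_atlas) x w) := by
  have h1 : MDifferentiableAt (𝓡 n) (QModel (n + 1)) (incl n M) x :=
    (contMDiff_incl x).mdifferentiableAt (by simp)
  have h2 : MDifferentiableAt (QModel (n + 1)) 𝓘(ℝ, EuclideanSpace ℝ (Fin (n + 1)))
      (e.extend (QModel (n + 1))) (incl n M x) :=
    (e.contMDiffAt_extend (n := ∞) (IsManifold.subset_maximalAtlas h.mem_atlas)
      h.mem_source).mdifferentiableAt (by simp)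
  set c := faceChart e i x h.mem_atlas with hc
  have hx : x ∈ c.source := h.mem_faceChart_source
  have h3 : MDifferentiableAt (𝓡 n) (𝓡 n) c x :=
    (contMDiffAt_of_mem_maximalAtlas (n := ∞)
      (IsManifold.subset_maximalAtlas (faceChart_mem_atlas e i x h.mem_atlas))
      hx).mdifferentiableAt (by simp)
  have h4 : HasMFDerivAt (𝓡 n) 𝓘(ℝ, EuclideanSpace ℝ (Fin (n + 1)))
      (faceIncl i ∘ c) x ((faceIncl i).comp (mfderiv (𝓡 n) (𝓡 n) c x)) :=
    ((faceIncl i).hasMFDerivAt (x := c x)).comp x h3.hasMFDerivAt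
  have h5 := h2.hasMFDerivAt.comp x h1.hasMFDerivAt
  have h6 : (e.extend (QModel (n + 1))) ∘ incl n M =ᶠ[𝓝 x] faceIncl i ∘ c := by
    filter_upwards [c.open_source.mem_nhds hx] with y hy
    exact (faceIncl_faceProj i _ (eq_zero_of_mem_stratum y.2 h.mem_atlas hy.1 hy.2)).symm
  have h7 := hasMFDerivAt_unique h5 (h4.congr_of_eventuallyEq h6)
  exact congrArg (fun T => T w) h7

theorem dIncl_injective (x : stratum (n + 1) M 1) : Function.Injective (dIncl x) := by
  obtain ⟨e, i, h⟩ := exists_isFaceChart x.2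
  have : IsManifold (𝓡 n) 1 (stratum (n + 1) M 1) := IsManifold.of_le (n := ∞) (by simp)
  have h1 := (mdifferentiable_of_mem_atlas (I := 𝓡 n)
    (faceChart_mem_atlas e i x h.mem_atlas)).mfderiv_injective h.mem_faceChart_source
  intro w w' hw
  have h2 := congrArg (dChart e (incl n M x)) hw
  rw [dChart_comp_dIncl h, dChart_comp_dIncl h] at h2
  apply h1
  exact (faceProj_faceIncl i _).symm.trans
    ((congrArg (faceProj i) h2).trans (faceProj_faceIncl i _))

theorem boundary_contraction_ne_zero (o : PointwiseOrientation (QModel (n + 1)) M)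
    (x : stratum (n + 1) M 1) {ν : TangentSpace (QModel (n + 1)) (incl n M x)}
    (hν : IsOutward x ν) :
    ((o (incl n M x)).someVector.curryLeft ν).compLinearMap (dIncl x).toLinearMap ≠ 0 := by
  obtain ⟨e, i, h, hneg⟩ := hν
  have hV : Module.finrank ℝ (TangentSpace (QModel (n + 1)) (incl n M x)) = n + 1 :=
    finrank_euclideanSpace_fin (𝕜 := ℝ) (n := n + 1)
  let b : Module.Basis (Fin n) ℝ (TangentSpace (𝓡 n) x) :=
    (EuclideanSpace.basisFun (Fin n) ℝ).toBasis
  let l : TangentSpace (QModel (n + 1)) (incl n M x) →ₗ[ℝ] ℝ :=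
    ((EuclideanSpace.proj i : EuclideanSpace ℝ (Fin (n + 1)) →L[ℝ] ℝ).comp
      (dChart e (incl n M x))).toLinearMap
  refine contraction_ne_zero hV b (Module.Ray.someVector_ne_zero _) _ (dIncl_injective x) l
    (fun w => ?_) (ν := ν) hneg.ne
  change dChart e (incl n M x) (dIncl x w) i = 0
  rw [dChart_comp_dIncl h]
  exact faceIncl_same i _

/-- The orientation of `∂¹M` as the boundary of `M` (outward normal first): if `ν` points outward
at `x`, then a frame `(w₁, …, wₙ)` of the tangent space of `∂¹M` is positive if and only
if the frame `(ν, w₁, …, wₙ)` of the tangent space of `M` is positive. -/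
def boundaryOrientation (o : PointwiseOrientation (QModel (n + 1)) M) :
    PointwiseOrientation (𝓡 n) (stratum (n + 1) M 1) := fun x =>
  rayOfNeZero ℝ
    (((o (incl n M x)).someVector.curryLeft (exists_isOutward x).choose).compLinearMap
      (dIncl x).toLinearMap)
    (boundary_contraction_ne_zero o x (exists_isOutward x).choose_spec)

end BoundaryOrientation

end CornerStokes
end

/-! A partition of unity reduces the theorem to forms supported in one chart: both integrals are
additive, since they can be computed in any countable family of disjoint pieces of charts covering
the support, where the integrand is linear in the form. For a form supported in one chart, the
fundamental theorem of calculus in each coordinate turns the integral of `dω` over the quadrant into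
integrals over its faces, the face on which the coordinate of index `i` (counted from `0`) vanishes
carrying the sign `(-1) ^ (i + 1)`. This is also the sign of the frame of that face for the boundary
orientation, as minus the `i`-th unit vector points outward. Neither the set of corners of
codimension `1` nor the notion of an outward vector depends on the chart, because the differential
of a coordinate change preserves the cone of inward vectors. -/

noncomputable section

namespace CornerStokes

section ChartForms

variable {E : Type*} [NormedAddCommGroup E] [NormedSpace ℝ E]
  {H : Type*} [TopologicalSpace H] {I : ModelWithCorners ℝ E H}
  {M : Type*} [TopologicalSpace M] {e e' : OpenPartialHomeomorph M H} {y : E}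

theorem extend_symm_mem_source (hy : y ∈ (e.extend I).target) : (e.extend I).symm y ∈ e.source :=
  e.extend_source (I := I) ▸ (e.extend I).map_target hy

theorem mem_extendCoordChange_source :
    y ∈ (I.extendCoordChange e e').source ↔
      y ∈ (e.extend I).target ∧ (e.extend I).symm y ∈ e'.source := by
  simp [ModelWithCorners.extendCoordChange]

theorem extend_mem_extendCoordChange_source {x : M} (hx : x ∈ e.source) (hx' : x ∈ e'.source) :
    e.extend I x ∈ (I.extendCoordChange e e').source := by
  rw [← e.extend_source (I := I)] at hx
  exact mem_extendCoordChange_source.2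
    ⟨(e.extend I).map_source hx, ((e.extend I).left_inv hx).symm ▸ hx'⟩

theorem extend_target_mem_nhdsWithin_range (hy : y ∈ (e.extend I).target) :
    (e.extend I).target ∈ 𝓝[range I] y := by
  have h := e.extend_target_mem_nhdsWithin (I := I) (extend_symm_mem_source hy)
  rwa [(e.extend I).right_inv hy] at h

theorem extendCoordChange_mapsTo : MapsTo (I.extendCoordChange e e') (range I) (range I) :=
  fun _ _ => mem_range_self _

theorem extendCoordChange_mem_target (hy : y ∈ (I.extendCoordChange e e').source) :
    I.extendCoordChange e e' y ∈ (e'.extend I).target :=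
  ((I.extendCoordChange e e').map_source hy).1

theorem extend_symm_extendCoordChange (hy : y ∈ (I.extendCoordChange e e').source) :
    (e'.extend I).symm (I.extendCoordChange e e' y) = (e.extend I).symm y :=
  (e'.extend I).left_inv (by rw [e'.extend_source]; exact (mem_extendCoordChange_source.1 hy).2)

theorem extendCoordChange_image {B : Set M} (hB : B ⊆ e.source) (hB' : B ⊆ e'.source) :
    I.extendCoordChange e e' '' ((e.extend I).target ∩ (e.extend I).symm ⁻¹' B) =
      (e'.extend I).target ∩ (e'.extend I).symm ⁻¹' B := by
  apply Subset.antisymm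
  · rintro _ ⟨y, hy, rfl⟩
    have hys := mem_extendCoordChange_source.2 ⟨hy.1, hB' hy.2⟩
    refine ⟨extendCoordChange_mem_target hys, ?_⟩
    rw [mem_preimage, extend_symm_extendCoordChange hys]
    exact hy.2
  · rintro z ⟨hz, hzB⟩
    have hzs : z ∈ (I.extendCoordChange e' e).source :=
      mem_extendCoordChange_source.2 ⟨hz, hB hzB⟩
    refine ⟨I.extendCoordChange e' e z, ⟨extendCoordChange_mem_target hzs, ?_⟩,
      (I.extendCoordChange e' e).left_inv hzs⟩
    rw [mem_preimage, extend_symm_extendCoordChange hzs]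
    exact hzB

variable [ChartedSpace H M]

theorem DiffForm.apply_congr {k : ℕ} (α : DiffForm I M k) {x x' : M} (hx : x = x')
    {v v' : Fin k → E} (hv : v = v') :
    (α x : E [⋀^Fin k]→L[ℝ] ℝ) v = (α x' : E [⋀^Fin k]→L[ℝ] ℝ) v' := by
  subst hx hv
  rfl

theorem chartRep_sum {k : ℕ} {ι : Type*} (s : Finset ι) (e : OpenPartialHomeomorph M H)
    (α : ι → DiffForm I M k) (y : E) :
    chartRep I e (∑ j ∈ s, α j) y = ∑ j ∈ s, chartRep I e (α j) y := by
  ext v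
  rw [chartRep, Finset.sum_apply, ContinuousAlternatingMap.compContinuousLinearMap_apply,
    ContinuousAlternatingMap.sum_apply, ContinuousAlternatingMap.sum_apply]
  rfl

theorem chartRep_eq_zero {k : ℕ} {α : DiffForm I M k} (h : α ((e.extend I).symm y) = 0) :
    chartRep I e α y = 0 := by
  ext v
  exact congrArg (fun T => T (fun j => dChartSymm I e y (v j))) h

theorem SmoothForm.differentiableWithinAt {k : ℕ} {α : DiffForm I M k}
    (hα : SmoothForm I α) (he : e ∈ atlas H M) (hy : y ∈ (e.extend I).target) :
    DifferentiableWithinAt ℝ (chartRep I e α) (range I) y :=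
  ((hα e he y hy).differentiableWithinAt (by simp)).mono_of_mem_nhdsWithin
    (extend_target_mem_nhdsWithin_range hy)

theorem eq_zero_of_notMem_closure {k : ℕ} {α : DiffForm I M k} {x : M}
    (hx : x ∉ closure {x : M | α x ≠ 0}) : α x = 0 :=
  not_not.1 fun h => hx (subset_closure h)

theorem extDer_eq_zero {k : ℕ} {α : DiffForm I M k} {x : M}
    (hx : x ∉ closure {x : M | α x ≠ 0}) : extDer I α x = 0 := by
  have hzero : chartRep I (chartAt H x) α =ᶠ[𝓝[range I] (extChartAt I x x)] fun _ => 0 := by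
    have hcont : ContinuousWithinAt (extChartAt I x).symm (range I) (extChartAt I x x) :=
      (continuousAt_extChartAt_symm x).continuousWithinAt
    have hnhds : (closure {x : M | α x ≠ 0})ᶜ ∈ 𝓝 ((extChartAt I x).symm (extChartAt I x x)) := by
      rw [extChartAt_to_inv]
      exact isClosed_closure.isOpen_compl.mem_nhds hx
    filter_upwards [hcont hnhds] with z hz
    exact chartRep_eq_zero (eq_zero_of_notMem_closure hz)
  have hderiv : extDerivWithin (chartRep I (chartAt H x) α) (range I) (extChartAt I x x) = 0 := by
    rw [hzero.extDerivWithin_eq_of_mem (mem_range_self _), extDerivWithin,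
      fderivWithin_const_apply]
    exact map_zero (ContinuousAlternatingMap.alternatizeUncurryFinCLM ℝ E ℝ)
  ext v
  simp only [extDer, hderiv]
  rfl

theorem extDer_sum {k : ℕ} {ι : Type*} (s : Finset ι) {α : ι → DiffForm I M k}
    (hα : ∀ j ∈ s, SmoothForm I (α j)) :
    extDer I (∑ j ∈ s, α j) = ∑ j ∈ s, extDer I (α j) := by
  funext x
  have hsum : extDerivWithin (chartRep I (chartAt H x) (∑ j ∈ s, α j)) (range I)
      (extChartAt I x x) = ∑ j ∈ s, extDerivWithin (chartRep I (chartAt H x) (α j)) (range I)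
        (extChartAt I x x) := by
    rw [funext (chartRep_sum s (chartAt H x) α)]
    simp only [extDerivWithin]
    rw [fderivWithin_fun_sum (I.uniqueDiffOn (extChartAt I x x) (mem_range_self _)) fun j hj =>
      (hα j hj).differentiableWithinAt (chart_mem_atlas H x) (mem_extChartAt_target x)]
    exact map_sum (ContinuousAlternatingMap.alternatizeUncurryFinCLM ℝ E ℝ) _ s
  ext v
  rw [Finset.sum_apply, ContinuousAlternatingMap.sum_apply]
  simp only [extDer, hsum]
  exact ContinuousAlternatingMap.sum_apply _ _

variable [IsManifold I ∞ M]

theorem contDiffWithinAt_coordChange (he : e ∈ atlas H M) (he' : e' ∈ atlas H M)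
    (hy : y ∈ (I.extendCoordChange e e').source) :
    ContDiffWithinAt ℝ ∞ (I.extendCoordChange e e') (range I) y :=
  I.contDiffWithinAt_extendCoordChange (IsManifold.subset_maximalAtlas he)
    (IsManifold.subset_maximalAtlas he') hy

theorem mdifferentiableWithinAt_extend_symm (he : e ∈ atlas H M) (hy : y ∈ (e.extend I).target) :
    MDifferentiableWithinAt 𝓘(ℝ, E) I (e.extend I).symm (range I) y := by
  have h := contMDiffOn_extend_symm (I := I) (n := ∞) (IsManifold.subset_maximalAtlas he) y
    (by rwa [← e.extend_target' (I := I)])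
  rw [← e.extend_target' (I := I)] at h
  exact (h.mdifferentiableWithinAt (by simp)).mono_of_mem_nhdsWithin
    (extend_target_mem_nhdsWithin_range hy)

theorem mdifferentiableAt_extend (he : e ∈ atlas H M) {x : M} (hx : x ∈ e.source) :
    MDifferentiableAt I 𝓘(ℝ, E) (e.extend I) x :=
  (e.contMDiffAt_extend (n := ∞) (IsManifold.subset_maximalAtlas he) hx).mdifferentiableAt
    (by simp)

theorem dChartSymm_coordChange (he : e ∈ atlas H M) (he' : e' ∈ atlas H M)
    (hy : y ∈ (I.extendCoordChange e e').source) (v : E) :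
    (dChartSymm I e y v : E) =
      dChartSymm I e' (I.extendCoordChange e e' y)
        (fderivWithin ℝ (I.extendCoordChange e e') (range I) y v) := by
  have hyr : y ∈ range I := e.extend_target_subset_range (mem_extendCoordChange_source.1 hy).1
  have hsymm : MDifferentiableWithinAt 𝓘(ℝ, E) I (e'.extend I).symm (range I)
      (I.extendCoordChange e e' y) :=
    mdifferentiableWithinAt_extend_symm he' (extendCoordChange_mem_target hy)
  have hchange : MDifferentiableWithinAt 𝓘(ℝ, E) 𝓘(ℝ, E) (I.extendCoordChange e e') (range I) y :=
    ((contDiffWithinAt_coordChange he he' hy).differentiableWithinAt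
      (by simp)).mdifferentiableWithinAt
  have hu : UniqueMDiffWithinAt 𝓘(ℝ, E) (range I) y := (I.uniqueDiffOn y hyr).uniqueMDiffWithinAt
  have hcomp : (e.extend I).symm =ᶠ[𝓝[range I] y]
      (e'.extend I).symm ∘ (I.extendCoordChange e e') := by
    filter_upwards [I.extendCoordChange_source_mem_nhdsWithin hy] with z hz
    exact (extend_symm_extendCoordChange hz).symm
  have hderiv := ((hsymm.hasMFDerivWithinAt.comp y hchange.hasMFDerivWithinAt
    extendCoordChange_mapsTo).congr_of_eventuallyEq hcomp
      (hcomp.self_of_nhdsWithin hyr)).mfderivWithin hu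
  rw [mfderivWithin_eq_fderivWithin] at hderiv
  exact congrArg (fun T : E →L[ℝ] E => T v) hderiv

theorem mfderiv_extend_comp_dChartSymm (he : e ∈ atlas H M) (he' : e' ∈ atlas H M)
    (hy : y ∈ (I.extendCoordChange e e').source) :
    (mfderiv I 𝓘(ℝ, E) (e'.extend I) ((e.extend I).symm y)).comp (dChartSymm I e y) =
      fderivWithin ℝ (I.extendCoordChange e e') (range I) y := by
  have hyt := mem_extendCoordChange_source.1 hy
  have hu : UniqueMDiffWithinAt 𝓘(ℝ, E) (range I) y :=
    (I.uniqueDiffOn y (e.extend_target_subset_range hyt.1)).uniqueMDiffWithinAt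
  rw [← mfderivWithin_eq_fderivWithin]
  exact (mfderiv_comp_mfderivWithin y (mdifferentiableAt_extend he' hyt.2)
    (mdifferentiableWithinAt_extend_symm he hyt.1) hu).symm

theorem mfderiv_extend_comp_dChartSymm_self (he : e ∈ atlas H M) (hy : y ∈ (e.extend I).target)
    (v : E) :
    mfderiv I 𝓘(ℝ, E) (e.extend I) ((e.extend I).symm y) (dChartSymm I e y v) = v := by
  have hyr := e.extend_target_subset_range hy
  have hcomp := mfderiv_extend_comp_dChartSymm (I := I) he he
    (mem_extendCoordChange_source.2 ⟨hy, extend_symm_mem_source hy⟩)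
  have hid : I.extendCoordChange e e =ᶠ[𝓝[range I] y] id := by
    filter_upwards [extend_target_mem_nhdsWithin_range hy] with z hz
    exact (e.extend I).right_inv hz
  rw [hid.fderivWithin_eq (hid.self_of_nhdsWithin hyr), fderivWithin_id (I.uniqueDiffOn y hyr)]
    at hcomp
  exact congrArg (fun T : E →L[ℝ] E => T v) hcomp

theorem chartRep_coordChange {k : ℕ} (he : e ∈ atlas H M) (he' : e' ∈ atlas H M)
    (hy : y ∈ (I.extendCoordChange e e').source) (α : DiffForm I M k) :
    chartRep I e α y = (chartRep I e' α (I.extendCoordChange e e' y)).compContinuousLinearMap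
      (fderivWithin ℝ (I.extendCoordChange e e') (range I) y) := by
  ext v
  exact DiffForm.apply_congr α (extend_symm_extendCoordChange hy).symm
    (funext fun j => dChartSymm_coordChange he he' hy (v j))

theorem chartRep_extDer {k : ℕ} {α : DiffForm I M k} (hα : SmoothForm I α) (he : e ∈ atlas H M)
    (hy : y ∈ (e.extend I).target) :
    chartRep I e (extDer I α) y = extDerivWithin (chartRep I e α) (range I) y := by
  have hyr := e.extend_target_subset_range hy
  set c := chartAt H ((e.extend I).symm y)
  have hca : c ∈ atlas H M := chart_mem_atlas H _
  have hys : y ∈ (I.extendCoordChange e c).source :=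
    mem_extendCoordChange_source.2 ⟨hy, mem_chart_source H _⟩
  have hrep : chartRep I e α =ᶠ[𝓝[range I] y] fun z =>
      (chartRep I c α (I.extendCoordChange e c z)).compContinuousLinearMap
        (fderivWithin ℝ (I.extendCoordChange e c) (range I) z) := by
    filter_upwards [I.extendCoordChange_source_mem_nhdsWithin hys] with z hz
    exact chartRep_coordChange he hca hz α
  have hd : DifferentiableWithinAt ℝ (chartRep I c α) (range I) (I.extendCoordChange e c y) :=
    hα.differentiableWithinAt hca (extendCoordChange_mem_target hys)
  rw [hrep.extDerivWithin_eq_of_mem hyr,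
    extDerivWithin_pullback (r := ∞) hd (contDiffWithinAt_coordChange he hca hys)
      (minSmoothness_of_isRCLikeNormedField.trans_le
        (WithTop.coe_le_coe.2 le_top : ((2 : ℕ∞) : WithTop ℕ∞) ≤ ∞)) I.uniqueDiffOn
      (I.range_subset_closure_interior hyr) hyr extendCoordChange_mapsTo,
    ← mfderiv_extend_comp_dChartSymm he hca hys]
  rfl

theorem SmoothForm.continuousOn_chartRep_extDer {k : ℕ} {α : DiffForm I M k}
    (hα : SmoothForm I α) (he : e ∈ atlas H M) :
    ContinuousOn (chartRep I e (extDer I α)) (e.extend I).target := by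
  have hcont : ContinuousOn (extDerivWithin (chartRep I e α) (e.extend I).target)
      (e.extend I).target := by
    have hu : UniqueDiffOn ℝ (e.extend I).target := by
      rw [e.extend_target]
      exact I.uniqueDiffOn_preimage e.open_target
    exact (ContinuousAlternatingMap.alternatizeUncurryFinCLM ℝ E ℝ).continuous.comp_continuousOn
      ((hα e he).continuousOn_fderivWithin hu (by simp))
  refine hcont.congr fun y hy => ?_
  rw [chartRep_extDer hα he hy, extDerivWithin, extDerivWithin,
    fderivWithin_of_mem_nhdsWithin (extend_target_mem_nhdsWithin_range hy)
      (I.uniqueDiffOn y (e.extend_target_subset_range hy))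
      ((hα e he y hy).differentiableWithinAt (by simp))]

theorem SmoothForm.smul {k : ℕ} {α : DiffForm I M k} (hα : SmoothForm I α) {ρ : M → ℝ}
    (hρ : ContMDiff I 𝓘(ℝ, ℝ) ∞ ρ) : SmoothForm I (M := M) (fun x => ρ x • α x) := by
  intro e he
  have hcomp : ContDiffOn ℝ ∞ (ρ ∘ (e.extend I).symm) (e.extend I).target := by
    have h := contMDiffOn_extend_symm (I := I) (n := ∞) (IsManifold.subset_maximalAtlas he)
    rw [← e.extend_target' (I := I)] at h
    exact (hρ.comp_contMDiffOn h).contDiffOn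
  exact hcomp.smul (hα e he)

end ChartForms

theorem measurableSet_inter_preimage {X Y : Type*} [TopologicalSpace X] [MeasurableSpace X]
    [OpensMeasurableSpace X] [TopologicalSpace Y] [MeasurableSpace Y] [BorelSpace Y]
    {f : X → Y} {s : Set X} (hf : ContinuousOn f s) (hs : MeasurableSet s) {B : Set Y}
    (hB : MeasurableSet B) : MeasurableSet (s ∩ f ⁻¹' B) := by
  rw [← Subtype.image_preimage_val]
  exact hs.subtype_image ((continuousOn_iff_continuous_domRestrict.1 hf).measurable hB)

section TopDegree

variable {ι V : Type*} [Finite ι] [AddCommGroup V]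

theorem topForm_comp_basis {R : Type*} [CommRing R] [Module R V]
    (b : Module.Basis ι R V) (ξ : V [⋀^ι]→ₗ[R] R) (L : V →ₗ[R] V) :
    ξ (L ∘ b) = LinearMap.det L * ξ b := by
  classical
  have := Fintype.ofFinite ι
  conv_lhs => rw [ξ.eq_smul_basis_det b, AlternatingMap.smul_apply, b.det_comp, b.det_self,
    mul_one, smul_eq_mul, mul_comm]

variable {K : Type*} [Field K] [Module K V]

theorem exists_topForm_eq_smul (b : Module.Basis ι K V) {φ : V [⋀^ι]→ₗ[K] K} (hφ : φ ≠ 0)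
    (η : V [⋀^ι]→ₗ[K] K) : ∃ c : K, η = c • φ := by
  classical
  have := Fintype.ofFinite ι
  have hb : φ b ≠ 0 := (φ.map_basis_ne_zero_iff b).2 hφ
  refine ⟨η b / φ b, ?_⟩
  calc η = η b • b.det := η.eq_smul_basis_det b
    _ = (η b / φ b) • φ b • b.det := by rw [smul_smul, div_mul_cancel₀ _ hb]
    _ = (η b / φ b) • φ := by rw [← φ.eq_smul_basis_det b]

theorem topForm_apply_ne_zero (b : Module.Basis ι K V) {φ : V [⋀^ι]→ₗ[K] K} (hφ : φ ≠ 0)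
    {v : ι → V} (hv : LinearIndependent K v) : φ v ≠ 0 := by
  have := Fintype.ofFinite ι
  have : FiniteDimensional K V := Module.Finite.of_basis b
  have hcard : Fintype.card ι = Module.finrank K V := (Module.finrank_eq_card_basis b).symm
  rw [← coe_basisOfLinearIndependentOfCardEqFinrank' v hv hcard]
  exact (φ.map_basis_ne_zero_iff _).2 hφ

theorem coe_basisFun_eq_stdFrame (k : ℕ) :
    ⇑(EuclideanSpace.basisFun (Fin k) ℝ).toBasis = stdFrame k := by
  ext i j
  simp [stdFrame]

end TopDegree

section Integration

variable {k : ℕ} {H : Type*} [TopologicalSpace H]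
  {I : ModelWithCorners ℝ (EuclideanSpace ℝ (Fin k)) H}
  {N : Type*} [TopologicalSpace N] {e e' : OpenPartialHomeomorph N H}

theorem measurableSet_extend_target : MeasurableSet (e.extend I).target := by
  rw [e.extend_target]
  exact (e.open_target.preimage I.continuous_symm).measurableSet.inter
    I.isClosed_range.measurableSet

variable [ChartedSpace H N]

theorem formSign_eq_zero {o : PointwiseOrientation I N} {η : DiffForm I N k} {x : N}
    (h : η x = 0) : formSign I o η x = 0 :=
  if_pos h

theorem formSign_eq_sign_of_eq_smul {o : PointwiseOrientation I N} {η : DiffForm I N k} {x : N}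
    {c : ℝ} (hc : (η x).toAlternatingMap = c • (o x).someVector) :
    formSign I o η x = SignType.sign c := by
  have hne := (o x).someVector_ne_zero
  have hzero : η x = 0 ↔ c = 0 := by
    rw [← ContinuousAlternatingMap.toAlternatingMap_injective.eq_iff, hc,
      ContinuousAlternatingMap.toAlternatingMap_zero, smul_eq_zero_iff_left hne]
  rcases eq_or_ne c 0 with rfl | hc0
  · simp [formSign_eq_zero (hzero.2 rfl)]
  rw [formSign, if_neg (hzero.not.2 hc0), hc]
  simp only [sameRay_smul_right_iff_of_ne hne hc0]
  rcases lt_or_gt_of_ne hc0 with h | h <;> simp [h, h.not_gt]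

theorem formSign_eq_frameSign_mul (o : PointwiseOrientation I N) (η : DiffForm I N k) (x : N)
    {v : Fin k → TangentSpace I x} (hv : (o x).someVector v ≠ 0) :
    formSign I o η x = (frameSign (o x) v : ℝ) * (SignType.sign (η x v) : ℝ) := by
  let b : Module.Basis (Fin k) ℝ (TangentSpace I x) :=
    (EuclideanSpace.basisFun (Fin k) ℝ).toBasis
  obtain ⟨c, hc⟩ := exists_topForm_eq_smul b (o x).someVector_ne_zero (η x).toAlternatingMap
  have hηv : η x v = c * (o x).someVector v := congrArg (fun T => T v) hc
  rw [formSign_eq_sign_of_eq_smul hc, hηv, frameSign, sign_mul]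
  rcases lt_or_gt_of_ne hv with h | h <;> simp [h]

/-- The sign, for the orientation `o`, of the coordinate frame of the chart `e`, as a function of the
coordinates. It is only meaningful on the target of `e`. -/
def chartSign (o : PointwiseOrientation I N) (e : OpenPartialHomeomorph N H)
    (y : EuclideanSpace ℝ (Fin k)) : ℝ :=
  (frameSign (o ((e.extend I).symm y)) (fun i => dChartSymm I e y (stdFrame k i)) : ℝ)

/-- The density of the form `η` relative to the orientation `o`, in the chart `e`. -/
def chartDensity (o : PointwiseOrientation I N) (η : DiffForm I N k)
    (e : OpenPartialHomeomorph N H) (y : EuclideanSpace ℝ (Fin k)) : ℝ :=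
  chartSign o e y * chartRep I e η y (stdFrame k)

/-- A form is continuous if it is continuous in every chart of the atlas. -/
def ContinuousForm {j : ℕ} (η : DiffForm I N j) : Prop :=
  ∀ e ∈ atlas H N, ContinuousOn (chartRep I e η) (e.extend I).target

theorem IsOrientation.continuousOn_chartSign {o : PointwiseOrientation I N}
    (ho : IsOrientation I o) (he : e ∈ atlas H N) :
    ContinuousOn (chartSign o e) (e.extend I).target := by
  intro y hy
  refine tendsto_const_nhds.congr' ?_
  filter_upwards [ho e he y hy] with z hz
  simp only [chartSign, hz]

theorem ContinuousForm.continuousOn_apply {j : ℕ} {η : DiffForm I N j} (hη : ContinuousForm η)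
    (he : e ∈ atlas H N) (v : Fin j → EuclideanSpace ℝ (Fin k)) :
    ContinuousOn (fun y => chartRep I e η y v) (e.extend I).target :=
  (ContinuousAlternatingMap.apply ℝ _ ℝ v).continuous.comp_continuousOn (hη e he)

variable {o : PointwiseOrientation I N}

theorem chartDensity_sum {ι : Type*} (s : Finset ι) (η : ι → DiffForm I N k)
    (y : EuclideanSpace ℝ (Fin k)) :
    chartDensity o (∑ j ∈ s, η j) e y = ∑ j ∈ s, chartDensity o (η j) e y := by
  simp only [chartDensity, chartRep_sum, ContinuousAlternatingMap.sum_apply, Finset.mul_sum]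

theorem ContinuousForm.sum {ι : Type*} {s : Finset ι} {η : ι → DiffForm I N k}
    (hη : ∀ j ∈ s, ContinuousForm (η j)) : ContinuousForm (∑ j ∈ s, η j) := by
  intro e he
  rw [funext (chartRep_sum s e η)]
  exact continuousOn_finsetSum s fun j hj => hη j hj e he

theorem ContinuousForm.continuousOn_chartDensity (ho : IsOrientation I o) {η : DiffForm I N k}
    (hη : ContinuousForm η) (he : e ∈ atlas H N) :
    ContinuousOn (chartDensity o η e) (e.extend I).target :=
  (ho.continuousOn_chartSign he).mul (hη.continuousOn_apply he _)

variable [IsManifold I ∞ N]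

theorem someVector_chartFrame_ne_zero (o : PointwiseOrientation I N) (he : e ∈ atlas H N)
    {y : EuclideanSpace ℝ (Fin k)} (hy : y ∈ (e.extend I).target) :
    (o ((e.extend I).symm y)).someVector (fun i => dChartSymm I e y (stdFrame k i)) ≠ 0 := by
  let b : Module.Basis (Fin k) ℝ (TangentSpace I ((e.extend I).symm y)) :=
    (EuclideanSpace.basisFun (Fin k) ℝ).toBasis
  have hinj : Function.Injective (dChartSymm I e y) :=
    Function.LeftInverse.injective (mfderiv_extend_comp_dChartSymm_self he hy)
  have hli : LinearIndependent ℝ (stdFrame k) :=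
    coe_basisFun_eq_stdFrame k ▸ (EuclideanSpace.basisFun (Fin k) ℝ).toBasis.linearIndependent
  exact topForm_apply_ne_zero b (o _).someVector_ne_zero
    (hli.map' (dChartSymm I e y).toLinearMap (LinearMap.ker_eq_bot.2 hinj))

theorem formSign_symm (o : PointwiseOrientation I N) (η : DiffForm I N k) (he : e ∈ atlas H N)
    {y : EuclideanSpace ℝ (Fin k)} (hy : y ∈ (e.extend I).target) :
    formSign I o η ((e.extend I).symm y) =
      chartSign o e y * (SignType.sign (chartRep I e η y (stdFrame k)) : ℝ) :=
  formSign_eq_frameSign_mul o η _ (someVector_chartFrame_ne_zero o he hy)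

theorem abs_mul_formSign_symm (o : PointwiseOrientation I N) (η : DiffForm I N k)
    (he : e ∈ atlas H N) {y : EuclideanSpace ℝ (Fin k)} (hy : y ∈ (e.extend I).target) :
    |chartRep I e η y (stdFrame k)| * formSign I o η ((e.extend I).symm y) =
      chartDensity o η e y := by
  rw [formSign_symm o η he hy, chartDensity, mul_left_comm, mul_comm (|_|), sign_mul_abs]

end Integration

section IsEmpty

variable {k : ℕ} {H : Type*} [TopologicalSpace H]
  {I : ModelWithCorners ℝ (EuclideanSpace ℝ (Fin k)) H} {N : Type*} [TopologicalSpace N]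
  [MeasurableSpace N] [ChartedSpace H N] [IsEmpty N]

theorem integrableForm_of_isEmpty (o : PointwiseOrientation I N)
    (η : DiffForm I N k) : IntegrableForm I o η := by
  rw [IntegrableForm, Measure.eq_zero_of_isEmpty (formMeasure I η)]
  exact integrable_zero_measure

theorem formIntegral_of_isEmpty (o : PointwiseOrientation I N)
    (η : DiffForm I N k) : formIntegral I o η = 0 :=
  integral_of_isEmpty

end IsEmpty

section FormMeasure

variable {k : ℕ} {H : Type*} [TopologicalSpace H]
  {I : ModelWithCorners ℝ (EuclideanSpace ℝ (Fin k)) H}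
  {N : Type*} [TopologicalSpace N] [MeasurableSpace N] [BorelSpace N]
  {e e' : OpenPartialHomeomorph N H}

theorem measurableSet_target_inter_preimage {B : Set N} (hB : MeasurableSet B) :
    MeasurableSet ((e.extend I).target ∩ (e.extend I).symm ⁻¹' B) :=
  measurableSet_inter_preimage e.continuousOn_extend_symm measurableSet_extend_target hB

theorem aemeasurable_extend_symm {S : Set (EuclideanSpace ℝ (Fin k))} (hS : MeasurableSet S)
    (hST : S ⊆ (e.extend I).target) (d : EuclideanSpace ℝ (Fin k) → ENNReal) :
    AEMeasurable (e.extend I).symm ((volume.restrict S).withDensity d) :=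
  ((e.continuousOn_extend_symm.mono hST).aemeasurable hS).mono_ac
    (withDensity_absolutelyContinuous _ _)

theorem map_extend_symm_apply {S : Set (EuclideanSpace ℝ (Fin k))} (hS : MeasurableSet S)
    (hST : S ⊆ (e.extend I).target) (d : EuclideanSpace ℝ (Fin k) → ENNReal) {B : Set N}
    (hB : MeasurableSet B) :
    Measure.map (e.extend I).symm ((volume.restrict S).withDensity d) B =
      ∫⁻ y in S ∩ (e.extend I).symm ⁻¹' B, d y := by
  rw [Measure.map_apply_of_aemeasurable (aemeasurable_extend_symm hS hST d) hB,
    withDensity_apply', Measure.restrict_restrict' hS, inter_comm]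

variable [ChartedSpace H N]

theorem chartMeasure_apply (η : DiffForm I N k) (e : OpenPartialHomeomorph N H) {B : Set N}
    (hB : MeasurableSet B) :
    chartMeasure I η e B = ∫⁻ y in (e.extend I).target ∩ (e.extend I).symm ⁻¹' B,
      ENNReal.ofReal |chartRep I e η y (stdFrame k)| :=
  map_extend_symm_apply measurableSet_extend_target subset_rfl _ hB

theorem chartMeasure_restrict (η : DiffForm I N k) (e : OpenPartialHomeomorph N H) {B : Set N}
    (hB : MeasurableSet B) :
    (chartMeasure I η e).restrict B = Measure.map (e.extend I).symm
      ((volume.restrict ((e.extend I).target ∩ (e.extend I).symm ⁻¹' B)).withDensity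
        fun y => ENNReal.ofReal |chartRep I e η y (stdFrame k)|) := by
  ext A hA
  rw [Measure.restrict_apply hA, chartMeasure_apply η e (hA.inter hB),
    map_extend_symm_apply (measurableSet_target_inter_preimage hB) inter_subset_left _ hA,
    inter_assoc, preimage_inter, inter_comm ((e.extend I).symm ⁻¹' A)]

theorem chartMeasure_restrict_source (η : DiffForm I N k) (e : OpenPartialHomeomorph N H) :
    (chartMeasure I η e).restrict e.source = chartMeasure I η e := by
  rw [chartMeasure_restrict η e e.open_source.measurableSet, chartMeasure,
    inter_eq_left.2 fun _ hy => mem_preimage.2 (extend_symm_mem_source hy)]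

theorem aemeasurable_density {η : DiffForm I N k} (hη : ContinuousForm η) (he : e ∈ atlas H N)
    {B : Set N} (hB : MeasurableSet B) :
    AEMeasurable (fun y => ENNReal.ofReal |chartRep I e η y (stdFrame k)|)
      (volume.restrict ((e.extend I).target ∩ (e.extend I).symm ⁻¹' B)) :=
  (((hη.continuousOn_apply he _).mono inter_subset_left).abs.aemeasurable
    (measurableSet_target_inter_preimage hB)).ennreal_ofReal

variable [IsManifold I ∞ N]

theorem chartMeasure_eq_of_subset (η : DiffForm I N k) (he : e ∈ atlas H N) (he' : e' ∈ atlas H N)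
    {B : Set N} (hB : MeasurableSet B) (hBe : B ⊆ e.source) (hBe' : B ⊆ e'.source) :
    chartMeasure I η e B = chartMeasure I η e' B := by
  rw [chartMeasure_apply η e hB, chartMeasure_apply η e' hB]
  set S := (e.extend I).target ∩ (e.extend I).symm ⁻¹' B
  have hS : MeasurableSet S := measurableSet_target_inter_preimage hB
  have hmem : ∀ y ∈ S, y ∈ (I.extendCoordChange e e').source := fun y hy =>
    mem_extendCoordChange_source.2 ⟨hy.1, hBe' hy.2⟩
  have hderiv : ∀ y ∈ S, HasFDerivWithinAt (I.extendCoordChange e e')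
      (fderivWithin ℝ (I.extendCoordChange e e') (range I) y) S y := fun y hy =>
    ((contDiffWithinAt_coordChange he he' (hmem y hy)).differentiableWithinAt
      (by simp)).hasFDerivWithinAt.mono fun _ hz => e.extend_target_subset_range hz.1
  rw [← extendCoordChange_image hBe hBe', lintegral_image_eq_lintegral_abs_det_fderiv_mul volume hS
    hderiv ((I.extendCoordChange e e').injOn.mono hmem)]
  refine setLIntegral_congr_fun hS fun y hy => ?_
  have hdet := topForm_comp_basis (EuclideanSpace.basisFun (Fin k) ℝ).toBasis
    (chartRep I e' η (I.extendCoordChange e e' y)).toAlternatingMap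
    (fderivWithin ℝ (I.extendCoordChange e e') (range I) y).toLinearMap
  rw [coe_basisFun_eq_stdFrame] at hdet
  rw [← ENNReal.ofReal_mul (abs_nonneg _), ← abs_mul, chartRep_coordChange he he' (hmem y hy)]
  exact congrArg (fun t : ℝ => ENNReal.ofReal |t|) hdet

theorem formMeasure_restrict_source (η : DiffForm I N k) (he : e ∈ atlas H N) :
    (formMeasure I η).restrict e.source = chartMeasure I η e := by
  have hm := e.open_source.measurableSet
  apply le_antisymm
  · have hle : formMeasure I η ≤
        chartMeasure I η e + (⊤ : Measure N).restrict e.sourceᶜ := by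
      refine iSup₂_le fun e' he' => ?_
      rw [← Measure.restrict_add_restrict_compl (μ := chartMeasure I η e') hm]
      refine add_le_add (Measure.le_iff.2 fun B hB => ?_) (Measure.restrict_mono subset_rfl le_top)
      rw [Measure.restrict_apply hB, ← chartMeasure_restrict_source η e',
        Measure.restrict_apply (hB.inter hm),
        chartMeasure_eq_of_subset η he' he ((hB.inter hm).inter e'.open_source.measurableSet)
          inter_subset_right (inter_subset_left.trans inter_subset_right)]
      exact measure_mono (inter_subset_left.trans inter_subset_left)
    refine (Measure.restrict_mono subset_rfl hle).trans ?_
    rw [Measure.restrict_add, Measure.restrict_restrict hm, inter_compl_self,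
      Measure.restrict_empty, add_zero, chartMeasure_restrict_source]
  · rw [← chartMeasure_restrict_source]
    exact Measure.restrict_mono subset_rfl (le_iSup₂_of_le e he le_rfl)

theorem formMeasure_restrict (η : DiffForm I N k) (he : e ∈ atlas H N) {B : Set N}
    (hB : MeasurableSet B) (hBe : B ⊆ e.source) :
    (formMeasure I η).restrict B = Measure.map (e.extend I).symm
      ((volume.restrict ((e.extend I).target ∩ (e.extend I).symm ⁻¹' B)).withDensity
        fun y => ENNReal.ofReal |chartRep I e η y (stdFrame k)|) := by
  rw [← chartMeasure_restrict η e hB, ← formMeasure_restrict_source η he,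
    Measure.restrict_restrict hB, inter_eq_left.2 hBe]

theorem measurable_sign_real : Measurable (fun t : ℝ => (SignType.sign t : ℝ)) := by
  refine Monotone.measurable fun a b hab => ?_
  have hsign : SignType.sign a ≤ SignType.sign b := SignType.sign.monotone hab
  generalize SignType.sign a = s, SignType.sign b = t at hsign ⊢
  cases s <;> cases t <;> simp_all

theorem measurableSet_source_inter_formSign_preimage {o : PointwiseOrientation I N}
    (ho : IsOrientation I o) {η : DiffForm I N k} (hη : ContinuousForm η) (he : e ∈ atlas H N)
    {B : Set ℝ} (hB : MeasurableSet B) : MeasurableSet (e.source ∩ formSign I o η ⁻¹' B) := by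
  have hcoord : e.source ∩ formSign I o η ⁻¹' B =
      e.source ∩ e.extend I ⁻¹' ((e.extend I).target ∩
        (fun y => (chartSign o e y, chartRep I e η y (stdFrame k))) ⁻¹'
          ((fun p : ℝ × ℝ => p.1 * (SignType.sign p.2 : ℝ)) ⁻¹' B)) := by
    ext z
    refine and_congr_right fun hz => ?_
    rw [← e.extend_source (I := I)] at hz
    have hzt := (e.extend I).map_source hz
    have hsign := formSign_symm o η he hzt
    rw [(e.extend I).left_inv hz] at hsign
    simp only [mem_preimage, mem_inter_iff, hsign, hzt, true_and]
  rw [hcoord]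
  refine measurableSet_inter_preimage (e.continuousOn_extend.mono e.extend_source.ge)
    e.open_source.measurableSet (measurableSet_inter_preimage
      ((ho.continuousOn_chartSign he).prodMk (hη.continuousOn_apply he _))
      measurableSet_extend_target ?_)
  exact (measurable_fst.mul (measurable_sign_real.comp measurable_snd)) hB

variable [SecondCountableTopology N]

theorem measurable_formSign {o : PointwiseOrientation I N} (ho : IsOrientation I o)
    {η : DiffForm I N k} (hη : ContinuousForm η) : Measurable (formSign I o η) := by
  obtain ⟨s, hs, hsu⟩ := TopologicalSpace.countable_cover_nhds
    (fun x : N => (chartAt H x).open_source.mem_nhds (mem_chart_source H x))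
  intro B hB
  rw [← univ_inter (_ ⁻¹' B), ← hsu, iUnion₂_inter]
  exact MeasurableSet.biUnion hs fun x _ =>
    measurableSet_source_inter_formSign_preimage ho hη (chart_mem_atlas H x) hB

variable {o : PointwiseOrientation I N}

theorem setIntegral_formSign (ho : IsOrientation I o) {η : DiffForm I N k}
    (hη : ContinuousForm η) (he : e ∈ atlas H N) {B : Set N} (hB : MeasurableSet B)
    (hBe : B ⊆ e.source) :
    ∫ x in B, formSign I o η x ∂(formMeasure I η) =
      ∫ y in (e.extend I).target ∩ (e.extend I).symm ⁻¹' B, chartDensity o η e y := by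
  have hS := measurableSet_target_inter_preimage (I := I) (e := e) hB
  rw [formMeasure_restrict η he hB hBe,
    integral_map (aemeasurable_extend_symm hS inter_subset_left _)
      (measurable_formSign ho hη).aestronglyMeasurable,
    integral_withDensity_eq_integral_toReal_smul₀ (aemeasurable_density hη he hB) (by simp)]
  refine setIntegral_congr_fun hS (fun y hy => ?_)
  rw [← abs_mul_formSign_symm o η he hy.1, ENNReal.toReal_ofReal (abs_nonneg _)]
  rfl

theorem setLIntegral_enorm_formSign (ho : IsOrientation I o) {η : DiffForm I N k}
    (hη : ContinuousForm η) (he : e ∈ atlas H N) {B : Set N} (hB : MeasurableSet B)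
    (hBe : B ⊆ e.source) :
    ∫⁻ x in B, ‖formSign I o η x‖ₑ ∂(formMeasure I η) =
      ∫⁻ y in (e.extend I).target ∩ (e.extend I).symm ⁻¹' B, ‖chartDensity o η e y‖ₑ := by
  have hS := measurableSet_target_inter_preimage (I := I) (e := e) hB
  have hmeas := (measurable_formSign ho hη).enorm
  have hsymm : AEMeasurable (e.extend I).symm
      (volume.restrict ((e.extend I).target ∩ (e.extend I).symm ⁻¹' B)) :=
    (e.continuousOn_extend_symm.mono inter_subset_left).aemeasurable hS
  rw [formMeasure_restrict η he hB hBe,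
    lintegral_map' hmeas.aemeasurable (aemeasurable_extend_symm hS inter_subset_left _),
    lintegral_withDensity_eq_lintegral_mul₀ (aemeasurable_density hη he hB)
      (g := fun y => ‖formSign I o η ((e.extend I).symm y)‖ₑ) (hmeas.comp_aemeasurable hsymm)]
  refine setLIntegral_congr_fun hS fun y hy => ?_
  rw [← abs_mul_formSign_symm o η he hy.1, enorm_mul, Real.enorm_abs, Pi.mul_apply,
    Real.enorm_eq_ofReal_abs (chartRep I e η y (stdFrame k))]

end FormMeasure

section ChartPacking

variable {k : ℕ} {H : Type*} [TopologicalSpace H]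
  {N : Type*} [TopologicalSpace N] [MeasurableSpace N] [ChartedSpace H N]

/-- A family of disjoint measurable sets, each contained in the domain of a chart of the atlas.
The integral of a form that vanishes outside their union is the sum of the integrals of its
densities in these charts. -/
structure ChartPacking (H N : Type*) [TopologicalSpace H] [TopologicalSpace N] [MeasurableSpace N]
    [ChartedSpace H N] (ι : Type*) where
  chart : ι → OpenPartialHomeomorph N H
  piece : ι → Set N
  mem_atlas : ∀ j, chart j ∈ atlas H N
  measurableSet_piece : ∀ j, MeasurableSet (piece j)
  pairwise_disjoint : Pairwise (Function.onFun Disjoint piece)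
  piece_subset_source : ∀ j, piece j ⊆ (chart j).source

namespace ChartPacking

/-- The packing whose pieces are the whole domains of charts. -/
def ofDisjointSources [OpensMeasurableSpace N] {ι : Type*} (c : ι → OpenPartialHomeomorph N H)
    (hc : ∀ j, c j ∈ atlas H N) (hd : Pairwise (Function.onFun Disjoint fun j => (c j).source)) :
    ChartPacking H N ι where
  chart := c
  piece j := (c j).source
  mem_atlas := hc
  measurableSet_piece j := (c j).open_source.measurableSet
  pairwise_disjoint := hd
  piece_subset_source _ := subset_rfl

/-- The `j`-th piece of the packing, in the coordinates of its chart. -/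
def domain (I : ModelWithCorners ℝ (EuclideanSpace ℝ (Fin k)) H) {ι : Type*}
    (P : ChartPacking H N ι) (j : ι) : Set (EuclideanSpace ℝ (Fin k)) :=
  ((P.chart j).extend I).target ∩ ((P.chart j).extend I).symm ⁻¹' P.piece j

variable {I : ModelWithCorners ℝ (EuclideanSpace ℝ (Fin k)) H}

theorem domain_ofDisjointSources [OpensMeasurableSpace N] {ι : Type*}
    {c : ι → OpenPartialHomeomorph N H} (hc : ∀ j, c j ∈ atlas H N)
    (hd : Pairwise (Function.onFun Disjoint fun j => (c j).source)) (j : ι) :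
    (ofDisjointSources c hc hd).domain I j = ((c j).extend I).target :=
  inter_eq_left.2 fun _ hy => mem_preimage.2 (extend_symm_mem_source hy)

variable (H N) in
theorem exists_iUnion_piece_eq_univ [OpensMeasurableSpace N] [SecondCountableTopology N] :
    ∃ (ι : Type) (_ : Countable ι) (P : ChartPacking H N ι), ⋃ j, P.piece j = univ := by
  rcases isEmpty_or_nonempty N with hN | hN
  · exact ⟨Empty, inferInstance, ofDisjointSources (fun j => j.elim) (fun j => j.elim)
      fun j => j.elim, Subsingleton.elim _ _⟩
  obtain ⟨s, hs, hcover⟩ := TopologicalSpace.countable_cover_nhds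
    (fun x : N => (chartAt H x).open_source.mem_nhds (mem_chart_source H x))
  obtain ⟨u, rfl⟩ := hs.exists_eq_range <| nonempty_iff_ne_empty.2 fun hempty =>
    empty_ne_univ (by rw [← hcover, hempty, biUnion_empty])
  refine ⟨ℕ, inferInstance,
    { chart := fun j => chartAt H (u j)
      piece := disjointed fun j => (chartAt H (u j)).source
      mem_atlas := fun j => chart_mem_atlas H _
      measurableSet_piece := MeasurableSet.disjointed fun j =>
        (chartAt H (u j)).open_source.measurableSet
      pairwise_disjoint := disjoint_disjointed _
      piece_subset_source := fun j => disjointed_subset _ j }, ?_⟩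
  rw [iUnion_disjointed, ← hcover, biUnion_range]

variable {ι : Type*} (P : ChartPacking H N ι)

theorem measurableSet_domain [BorelSpace N] (j : ι) : MeasurableSet (P.domain I j) :=
  measurableSet_target_inter_preimage (P.measurableSet_piece j)

variable {o : PointwiseOrientation I N} {η : DiffForm I N k}

theorem continuousOn_chartDensity (ho : IsOrientation I o) (hη : ContinuousForm η) (j : ι) :
    ContinuousOn (chartDensity o η (P.chart j)) (P.domain I j) :=
  (hη.continuousOn_chartDensity ho (P.mem_atlas j)).mono inter_subset_left

variable [BorelSpace N] [IsManifold I ∞ N] [SecondCountableTopology N] [Countable ι]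

theorem lintegral_enorm_formSign (ho : IsOrientation I o) (hη : ContinuousForm η)
    (hz : ∀ x ∉ ⋃ j, P.piece j, η x = 0) :
    ∫⁻ x, ‖formSign I o η x‖ₑ ∂(formMeasure I η) =
      ∑' j, ∫⁻ y in P.domain I j, ‖chartDensity o η (P.chart j) y‖ₑ := by
  have hsupp : (Function.support fun x => ‖formSign I o η x‖ₑ) ⊆ ⋃ j, P.piece j := fun x hx =>
    of_not_not fun hxP => hx (by simp only [formSign_eq_zero (hz x hxP), enorm_zero])
  rw [← setLIntegral_eq_of_support_subset hsupp,
    lintegral_iUnion P.measurableSet_piece P.pairwise_disjoint]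
  exact tsum_congr fun j => setLIntegral_enorm_formSign ho hη (P.mem_atlas j)
    (P.measurableSet_piece j) (P.piece_subset_source j)

theorem integrableForm_iff (ho : IsOrientation I o) (hη : ContinuousForm η)
    (hz : ∀ x ∉ ⋃ j, P.piece j, η x = 0) :
    IntegrableForm I o η ↔
      ∑' j, ∫⁻ y in P.domain I j, ‖chartDensity o η (P.chart j) y‖ₑ < ⊤ := by
  rw [← P.lintegral_enorm_formSign ho hη hz]
  exact and_iff_right (measurable_formSign ho hη).aestronglyMeasurable

theorem integrableOn_chartDensity (ho : IsOrientation I o) (hη : ContinuousForm η)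
    (hz : ∀ x ∉ ⋃ j, P.piece j, η x = 0) (hi : IntegrableForm I o η) (j : ι) :
    IntegrableOn (chartDensity o η (P.chart j)) (P.domain I j) :=
  ⟨(P.continuousOn_chartDensity ho hη j).aestronglyMeasurable (P.measurableSet_domain j),
    (ENNReal.le_tsum j).trans_lt ((P.integrableForm_iff ho hη hz).1 hi)⟩

theorem hasSum_formIntegral (ho : IsOrientation I o) (hη : ContinuousForm η)
    (hz : ∀ x ∉ ⋃ j, P.piece j, η x = 0) (hi : IntegrableForm I o η) :
    HasSum (fun j => ∫ y in P.domain I j, chartDensity o η (P.chart j) y)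
      (formIntegral I o η) := by
  have hsum := hasSum_integral_iUnion P.measurableSet_piece P.pairwise_disjoint
    (f := formSign I o η) (μ := formMeasure I η) hi.integrableOn
  rw [setIntegral_eq_integral_of_forall_compl_eq_zero
    fun x hx => formSign_eq_zero (hz x hx)] at hsum
  exact hsum.congr_fun fun j => (setIntegral_formSign ho hη (P.mem_atlas j)
    (P.measurableSet_piece j) (P.piece_subset_source j)).symm

end ChartPacking

variable {I : ModelWithCorners ℝ (EuclideanSpace ℝ (Fin k)) H} [BorelSpace N]
  [IsManifold I ∞ N] [SecondCountableTopology N] {o : PointwiseOrientation I N}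

theorem integrableForm_sum (ho : IsOrientation I o) {ι : Type*} {s : Finset ι}
    {η : ι → DiffForm I N k} (hη : ∀ j ∈ s, ContinuousForm (η j))
    (hi : ∀ j ∈ s, IntegrableForm I o (η j)) : IntegrableForm I o (∑ j ∈ s, η j) := by
  obtain ⟨κ, _, P, hP⟩ := ChartPacking.exists_iUnion_piece_eq_univ H N
  have hz (ζ : DiffForm I N k) : ∀ x ∉ ⋃ a, P.piece a, ζ x = 0 := fun x hx =>
    absurd (hP ▸ mem_univ x) hx
  rw [P.integrableForm_iff ho (ContinuousForm.sum hη) (hz _)]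
  calc ∑' a, ∫⁻ y in P.domain I a, ‖chartDensity o (∑ j ∈ s, η j) (P.chart a) y‖ₑ
    _ ≤ ∑' a, ∫⁻ y in P.domain I a, ∑ j ∈ s, ‖chartDensity o (η j) (P.chart a) y‖ₑ :=
        ENNReal.tsum_le_tsum fun a => lintegral_mono fun y => by
          rw [chartDensity_sum]
          exact enorm_sum_le _ _
    _ = ∑' a, ∑ j ∈ s, ∫⁻ y in P.domain I a, ‖chartDensity o (η j) (P.chart a) y‖ₑ :=
        tsum_congr fun a => lintegral_finsetSum' s fun j hj =>
          ((P.continuousOn_chartDensity ho (hη j hj) a).aemeasurable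
            (P.measurableSet_domain a)).enorm
    _ = ∑ j ∈ s, ∑' a, ∫⁻ y in P.domain I a, ‖chartDensity o (η j) (P.chart a) y‖ₑ :=
        Summable.tsum_finsetSum fun _ _ => ENNReal.summable
    _ < ⊤ := ENNReal.sum_lt_top.2 fun j hj =>
        (P.integrableForm_iff ho (hη j hj) (hz _)).1 (hi j hj)

theorem formIntegral_sum (ho : IsOrientation I o) {ι : Type*} {s : Finset ι}
    {η : ι → DiffForm I N k} (hη : ∀ j ∈ s, ContinuousForm (η j))
    (hi : ∀ j ∈ s, IntegrableForm I o (η j)) :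
    formIntegral I o (∑ j ∈ s, η j) = ∑ j ∈ s, formIntegral I o (η j) := by
  obtain ⟨κ, _, P, hP⟩ := ChartPacking.exists_iUnion_piece_eq_univ H N
  have hz (ζ : DiffForm I N k) : ∀ x ∉ ⋃ a, P.piece a, ζ x = 0 := fun x hx =>
    absurd (hP ▸ mem_univ x) hx
  refine (P.hasSum_formIntegral ho (ContinuousForm.sum hη) (hz _)
    (integrableForm_sum ho hη hi)).unique ?_
  refine (hasSum_sum fun j hj =>
    P.hasSum_formIntegral ho (hη j hj) (hz _) (hi j hj)).congr_fun fun a => ?_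
  simp only [chartDensity_sum]
  exact integral_finsetSum s fun j hj =>
    P.integrableOn_chartDensity ho (hη j hj) (hz _) (hi j hj) a

theorem formIntegral_eq_sum_of_disjoint_sources (ho : IsOrientation I o) {η : DiffForm I N k}
    (hη : ContinuousForm η) {ι : Type*} [Fintype ι] {c : ι → OpenPartialHomeomorph N H}
    (hc : ∀ j, c j ∈ atlas H N) (hd : Pairwise (Function.onFun Disjoint fun j => (c j).source))
    (hz : ∀ x ∉ ⋃ j, (c j).source, η x = 0)
    (hi : ∀ j, IntegrableOn (chartDensity o η (c j)) ((c j).extend I).target) :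
    IntegrableForm I o η ∧
      formIntegral I o η = ∑ j, ∫ y in ((c j).extend I).target, chartDensity o η (c j) y := by
  let P := ChartPacking.ofDisjointSources c hc hd
  have hdom : ∀ j, P.domain I j = ((c j).extend I).target :=
    ChartPacking.domain_ofDisjointSources hc hd
  have hint : IntegrableForm I o η := by
    rw [P.integrableForm_iff ho hη hz, tsum_fintype]
    exact ENNReal.sum_lt_top.2 fun j _ => hdom j ▸ (hi j).2
  refine ⟨hint, ((P.hasSum_formIntegral ho hη hz hint).unique (hasSum_fintype _)).trans ?_⟩
  simp only [hdom]
  rfl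

end ChartPacking

section Quadrant

theorem setIntegral_toLp {m : ℕ} (g : EuclideanSpace ℝ (Fin m) → ℝ)
    (S : Set (EuclideanSpace ℝ (Fin m))) :
    ∫ x in WithLp.toLp 2 ⁻¹' S, g (WithLp.toLp 2 x) = ∫ y in S, g y :=
  (PiLp.volume_preserving_toLp (Fin m)).setIntegral_preimage_emb
    (MeasurableEquiv.toLp 2 (Fin m → ℝ)).measurableEmbedding g S

theorem preimage_toLp_range_qModel (m : ℕ) :
    WithLp.toLp 2 ⁻¹' range (QModel m) = Ici (0 : Fin m → ℝ) := by
  rw [range_qModel]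
  rfl

theorem setOf_pos_ae_eq_range_qModel (m : ℕ) :
    {u : EuclideanSpace ℝ (Fin m) | ∀ j, 0 < u j} =ᵐ[volume] range (QModel m) := by
  rw [← interior_range_qModel]
  exact interior_ae_eq_of_null_frontier ((QModel m).convex_range.addHaar_frontier volume)

theorem exists_forall_coord_lt {m : ℕ} {K : Set (EuclideanSpace ℝ (Fin m))} (hK : IsCompact K) :
    ∃ R : ℝ, 0 < R ∧ ∀ y ∈ K, ∀ i, y i < R := by
  obtain ⟨R, hR, hKR⟩ := hK.isBounded.exists_pos_norm_lt
  exact ⟨R, hR, fun y hy i => ((Real.le_norm_self _).trans (PiLp.norm_apply_le y i)).trans_lt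
    (hKR y hy)⟩

theorem integrableOn_of_continuousOn_of_isCompact {X F : Type*} [TopologicalSpace X]
    [MeasurableSpace X] [OpensMeasurableSpace X] [T2Space X] {μ : Measure X}
    [IsFiniteMeasureOnCompacts μ] [NormedAddCommGroup F] {f : X → F} {S K : Set X}
    (hS : IsClosed S) (hf : ContinuousOn f S) (hK : IsCompact K) (hz : ∀ x ∉ K, f x = 0) :
    IntegrableOn f S μ :=
  ((hf.mono inter_subset_left).integrableOn_compact (hK.inter_left hS)).of_forall_sdiff_eq_zero
    hS.measurableSet fun x hx => hz x fun hxK => hx.2 ⟨hx.1, hxK⟩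

theorem fderivWithin_eq_zero_of_notMem {E F : Type*} [NormedAddCommGroup E] [NormedSpace ℝ E]
    [NormedAddCommGroup F] [NormedSpace ℝ F] {f : E → F} {s K : Set E} (hK : IsClosed K)
    (hz : ∀ y ∉ K, f y = 0) {y : E} (hy : y ∉ K) : fderivWithin ℝ f s y = 0 := by
  have hzero : f =ᶠ[𝓝 y] fun _ => 0 := by
    filter_upwards [hK.isOpen_compl.mem_nhds hy] with z hzK using hz z hzK
  rw [hzero.fderivWithin_eq_of_nhds, fderivWithin_const_apply]

section Box

variable {m : ℕ} {g : EuclideanSpace ℝ (Fin m) → ℝ} {R : ℝ}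

theorem continuousOn_comp_toLp_Icc (hg : ContinuousOn g (range (QModel m))) :
    ContinuousOn (fun x => g (WithLp.toLp 2 x)) (Icc (0 : Fin m → ℝ) fun _ => R) := by
  refine hg.comp (PiLp.continuous_toLp 2 _).continuousOn fun x hx => ?_
  rw [← mem_preimage, preimage_toLp_range_qModel]
  exact hx.1

theorem setIntegral_range_qModel (hz : ∀ u, (∃ j, R ≤ u j) → g u = 0) :
    ∫ u in range (QModel m), g u =
      ∫ x in Icc (0 : Fin m → ℝ) (fun _ => R), g (WithLp.toLp 2 x) := by
  rw [← setIntegral_toLp, preimage_toLp_range_qModel]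
  refine setIntegral_eq_of_subset_of_forall_sdiff_eq_zero measurableSet_Ici Icc_subset_Ici_self ?_
  rintro x ⟨hx, hxR⟩
  refine hz _ ?_
  by_contra! hlt
  exact hxR ⟨hx, fun j => (hlt j).le⟩

theorem hasFDerivAt_comp_toLp (hg : ContDiffOn ℝ 1 g (range (QModel m))) {x : Fin m → ℝ}
    (hx : ∀ i, 0 < x i) :
    HasFDerivAt (fun x => g (WithLp.toLp 2 x))
      ((fderivWithin ℝ g (range (QModel m)) (WithLp.toLp 2 x)).comp
        (PiLp.continuousLinearEquiv 2 ℝ fun _ : Fin m => ℝ).symm.toContinuousLinearMap) x := by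
  have hmem : range (QModel m) ∈ 𝓝 (WithLp.toLp 2 x) := by
    rw [← mem_interior_iff_mem_nhds, interior_range_qModel]
    exact hx
  exact ((hg.differentiableOn one_ne_zero _
    (mem_of_mem_nhds hmem)).hasFDerivWithinAt.hasFDerivAt hmem).comp x
      (PiLp.continuousLinearEquiv 2 ℝ fun _ : Fin m => ℝ).symm.toContinuousLinearMap.hasFDerivAt

end Box

variable {n : ℕ}

theorem faceIncl_mem_range_qModel (i : Fin (n + 1)) {u : EuclideanSpace ℝ (Fin n)}
    (hu : u ∈ range (QModel n)) : faceIncl i u ∈ range (QModel (n + 1)) := by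
  rw [range_qModel] at hu ⊢
  exact Fin.succAboveCases i (by simp) fun j => by simpa using hu j

theorem setIntegral_Icc_divergence {R : ℝ} (hR : 0 ≤ R)
    {f : Fin (n + 1) → EuclideanSpace ℝ (Fin (n + 1)) → ℝ}
    (hf : ∀ i, ContDiffOn ℝ 1 (f i) (range (QModel (n + 1))))
    (hz : ∀ i u, (∃ j, R ≤ u j) → f i u = 0) :
    ∫ x in Icc (0 : Fin (n + 1) → ℝ) (fun _ => R),
        ∑ i, fderivWithin ℝ (f i) (range (QModel (n + 1))) (WithLp.toLp 2 x)
          (stdFrame (n + 1) i) =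
      -∑ i, ∫ x in Icc (0 : Fin n → ℝ) (fun _ => R), f i (faceIncl i (WithLp.toLp 2 x)) := by
  set Q := range (QModel (n + 1))
  let L : (Fin (n + 1) → ℝ) →L[ℝ] EuclideanSpace ℝ (Fin (n + 1)) :=
    (PiLp.continuousLinearEquiv 2 ℝ (fun _ : Fin (n + 1) => ℝ)).symm.toContinuousLinearMap
  have hstd : ∀ i, L (Pi.single i 1) = stdFrame (n + 1) i := fun i => by
    ext l
    simp [L, stdFrame]
  have hcont : ContinuousOn (fun y => ∑ i, fderivWithin ℝ (f i) Q y (stdFrame (n + 1) i)) Q :=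
    continuousOn_finsetSum _ fun i _ => ((hf i).continuousOn_fderivWithin
      (QModel (n + 1)).uniqueDiffOn le_rfl).clm_apply continuousOn_const
  have hdiv := integral_divergence_of_hasFDerivAt_off_countable' (0 : Fin (n + 1) → ℝ)
    (fun _ => R) (fun _ => hR) (fun i x => f i (L x))
    (fun i x => (fderivWithin ℝ (f i) Q (L x)).comp L) ∅ countable_empty
    (fun i => continuousOn_comp_toLp_Icc (hf i).continuousOn) (fun x hx i =>
      hasFDerivAt_comp_toLp (hf i) fun j => (hx.1 j (mem_univ j)).1)
    (by
      simp only [ContinuousLinearMap.comp_apply, hstd]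
      exact (continuousOn_comp_toLp_Icc hcont).integrableOn_compact isCompact_Icc)
  simp only [ContinuousLinearMap.comp_apply, hstd] at hdiv
  refine hdiv.trans ?_
  have hfar : ∀ i (x : Fin n → ℝ), f i (L (i.insertNth R x)) = 0 := fun i x =>
    hz i _ ⟨i, by simp [L]⟩
  simp only [hfar, integral_zero, zero_sub, Finset.sum_neg_distrib]
  rfl

theorem setIntegral_qModel_divergence {f : Fin (n + 1) → EuclideanSpace ℝ (Fin (n + 1)) → ℝ}
    (hf : ∀ i, ContDiffOn ℝ 1 (f i) (range (QModel (n + 1))))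
    {K : Set (EuclideanSpace ℝ (Fin (n + 1)))} (hK : IsCompact K) (hz : ∀ i, ∀ y ∉ K, f i y = 0) :
    ∫ y in range (QModel (n + 1)),
        ∑ i, fderivWithin ℝ (f i) (range (QModel (n + 1))) y (stdFrame (n + 1) i) =
      -∑ i, ∫ u in range (QModel n), f i (faceIncl i u) := by
  obtain ⟨R, hR, hKR⟩ := exists_forall_coord_lt hK
  have hfar : ∀ y : EuclideanSpace ℝ (Fin (n + 1)), (∃ j, R ≤ y j) → y ∉ K :=
    fun y ⟨j, hj⟩ hy => (hKR y hy j).not_ge hj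
  rw [setIntegral_range_qModel (R := R) fun y hy => Finset.sum_eq_zero fun i _ => by
      rw [fderivWithin_eq_zero_of_notMem hK.isClosed (hz i) (hfar y hy), zero_apply],
    setIntegral_Icc_divergence hR.le hf fun i y hy => hz i y (hfar y hy)]
  refine congrArg _ (Finset.sum_congr rfl fun i _ =>
    (setIntegral_range_qModel (g := fun u => f i (faceIncl i u)) ?_).symm)
  rintro u ⟨j, hj⟩
  exact hz i _ (hfar _ ⟨i.succAbove j, by simpa using hj⟩)

section Forms

variable {E F : Type*} [NormedAddCommGroup E] [NormedSpace ℝ E] [NormedAddCommGroup F]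
  [NormedSpace ℝ F] {k : ℕ} {β : E → E [⋀^Fin k]→L[ℝ] F} {s : Set E}

theorem extDerivWithin_eq_zero_of_notMem {K : Set E} (hK : IsClosed K) (hz : ∀ y ∉ K, β y = 0)
    {y : E} (hy : y ∉ K) : extDerivWithin β s y = 0 := by
  rw [extDerivWithin, fderivWithin_eq_zero_of_notMem hK hz hy]
  exact map_zero (ContinuousAlternatingMap.alternatizeUncurryFinCLM ℝ E F)

theorem continuousOn_extDerivWithin (hβ : ContDiffOn ℝ 1 β s) (hs : UniqueDiffOn ℝ s) :
    ContinuousOn (extDerivWithin β s) s :=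
  (ContinuousAlternatingMap.alternatizeUncurryFinCLM ℝ E F).continuous.comp_continuousOn
    (hβ.continuousOn_fderivWithin hs le_rfl)

end Forms

variable {β : EuclideanSpace ℝ (Fin (n + 1)) → EuclideanSpace ℝ (Fin (n + 1)) [⋀^Fin n]→L[ℝ] ℝ}
  {s K : Set (EuclideanSpace ℝ (Fin (n + 1)))}

theorem removeNth_stdFrame (i : Fin (n + 1)) :
    i.removeNth (stdFrame (n + 1)) = fun j => faceIncl i (stdFrame n j) := by
  ext j l
  refine Fin.succAboveCases i ?_ (fun l => ?_) l <;> simp [Fin.removeNth, stdFrame]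

theorem extDerivWithin_apply_stdFrame {y : EuclideanSpace ℝ (Fin (n + 1))}
    (hβ : DifferentiableWithinAt ℝ β s y) (hs : UniqueDiffWithinAt ℝ s y) :
    extDerivWithin β s y (stdFrame (n + 1)) =
      ∑ i : Fin (n + 1), fderivWithin ℝ
        (fun z => (-1) ^ i.val * β z fun j => faceIncl i (stdFrame n j)) s y
          (stdFrame (n + 1) i) := by
  refine (extDerivWithin_apply hβ hs _).trans (Finset.sum_congr rfl fun i _ => ?_)
  have hcoeff : DifferentiableWithinAt ℝ (fun z => β z fun j => faceIncl i (stdFrame n j)) s y :=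
    (ContinuousAlternatingMap.apply ℝ _ ℝ
      fun j => faceIncl i (stdFrame n j)).differentiableAt.comp_differentiableWithinAt y hβ
  rw [removeNth_stdFrame, fderivWithin_const_mul hs hcoeff, smul_apply, smul_eq_mul]
  simp

theorem integrableOn_extDerivWithin_qModel (hβ : ContDiffOn ℝ 1 β (range (QModel (n + 1))))
    (hK : IsCompact K) (hz : ∀ y ∉ K, β y = 0) (v : Fin (n + 1) → EuclideanSpace ℝ (Fin (n + 1))) :
    IntegrableOn (fun y => extDerivWithin β (range (QModel (n + 1))) y v)
      (range (QModel (n + 1))) := by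
  refine integrableOn_of_continuousOn_of_isCompact (QModel (n + 1)).isClosed_range
    ((ContinuousAlternatingMap.apply ℝ _ ℝ v).continuous.comp_continuousOn
      (continuousOn_extDerivWithin hβ (QModel (n + 1)).uniqueDiffOn)) hK fun y hy => ?_
  rw [extDerivWithin_eq_zero_of_notMem hK.isClosed hz hy]
  rfl

theorem integrableOn_comp_faceIncl (hβ : ContinuousOn β (range (QModel (n + 1))))
    (hK : IsCompact K) (hz : ∀ y ∉ K, β y = 0) (i : Fin (n + 1))
    (v : Fin n → EuclideanSpace ℝ (Fin (n + 1))) :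
    IntegrableOn (fun u => β (faceIncl i u) v) (range (QModel n)) := by
  refine integrableOn_of_continuousOn_of_isCompact (QModel n).isClosed_range
    ((ContinuousAlternatingMap.apply ℝ _ ℝ v).continuous.comp_continuousOn
      (hβ.comp (faceIncl i).continuous.continuousOn fun u => faceIncl_mem_range_qModel i))
    (hK.image (faceProj i).continuous) fun u hu => ?_
  rw [hz _ fun huK => hu ⟨_, huK, faceProj_faceIncl i u⟩]
  rfl

theorem stokes_quadrant (hβ : ContDiffOn ℝ 1 β (range (QModel (n + 1)))) (hK : IsCompact K)
    (hz : ∀ y ∉ K, β y = 0) :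
    ∫ y in range (QModel (n + 1)),
        extDerivWithin β (range (QModel (n + 1))) y (stdFrame (n + 1)) =
      ∑ i : Fin (n + 1), (-1) ^ (i.val + 1) * ∫ u in range (QModel n),
        β (faceIncl i u) fun j => faceIncl i (stdFrame n j) := by
  let f (i : Fin (n + 1)) (y : EuclideanSpace ℝ (Fin (n + 1))) : ℝ :=
    (-1) ^ i.val * β y fun j => faceIncl i (stdFrame n j)
  have hf : ∀ i, ContDiffOn ℝ 1 (f i) (range (QModel (n + 1))) := fun i =>
    contDiffOn_const.mul ((ContinuousAlternatingMap.apply ℝ _ ℝ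
      fun j => faceIncl i (stdFrame n j)).contDiff.comp_contDiffOn hβ)
  have hfz : ∀ i, ∀ y ∉ K, f i y = 0 := fun i y hy => by
    simp only [f, hz y hy]
    exact mul_zero _
  calc
    _ = ∫ y in range (QModel (n + 1)),
          ∑ i, fderivWithin ℝ (f i) (range (QModel (n + 1))) y (stdFrame (n + 1) i) :=
        setIntegral_congr_fun (QModel (n + 1)).isClosed_range.measurableSet fun y hy =>
          extDerivWithin_apply_stdFrame ((hβ.differentiableOn one_ne_zero) y hy)
            ((QModel (n + 1)).uniqueDiffOn y hy)
    _ = -∑ i, ∫ u in range (QModel n), f i (faceIncl i u) :=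
        setIntegral_qModel_divergence hf hK hfz
    _ = _ := by
        rw [← Finset.sum_neg_distrib]
        refine Finset.sum_congr rfl fun i _ => ?_
        rw [integral_const_mul, pow_succ, mul_neg_one, neg_mul]

end Quadrant

theorem mfderiv_extend_coordChange {E : Type*} [NormedAddCommGroup E] [NormedSpace ℝ E]
    {H : Type*} [TopologicalSpace H] {I : ModelWithCorners ℝ E H}
    {M : Type*} [TopologicalSpace M] [ChartedSpace H M] [IsManifold I ∞ M]
    {e e' : OpenPartialHomeomorph M H} (he : e ∈ atlas H M) (he' : e' ∈ atlas H M)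
    {x : M} (hx : x ∈ e.source) (hx' : x ∈ e'.source) (v : TangentSpace I x) :
    (mfderiv I 𝓘(ℝ, E) (e'.extend I) x v : E) =
      fderivWithin ℝ (I.extendCoordChange e e') (range I) (e.extend I x)
        (mfderiv I 𝓘(ℝ, E) (e.extend I) x v : E) := by
  have hchange : HasMFDerivWithinAt 𝓘(ℝ, E) 𝓘(ℝ, E) (I.extendCoordChange e e') (range I)
      (e.extend I x) (fderivWithin ℝ (I.extendCoordChange e e') (range I) (e.extend I x)) :=
    ((contDiffWithinAt_coordChange he he'
      (extend_mem_extendCoordChange_source hx hx')).differentiableWithinAt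
        (by simp)).hasFDerivWithinAt.hasMFDerivWithinAt
  have hcomp := hchange.comp x (mdifferentiableAt_extend he hx).hasMFDerivAt.hasMFDerivWithinAt
    (s := univ) fun z _ => mem_range_self _
  rw [hasMFDerivWithinAt_univ] at hcomp
  have heq : e'.extend I =ᶠ[𝓝 x] I.extendCoordChange e e' ∘ e.extend I := by
    filter_upwards [e.open_source.mem_nhds hx] with z hz
    exact congrArg (e'.extend I) ((e.extend I).left_inv (by rwa [e.extend_source])).symm
  exact congrArg (fun T : E →L[ℝ] E => T v) (hcomp.congr_of_eventuallyEq heq).mfderiv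

section Corners

theorem mem_posTangentConeAt_range_qModel {m : ℕ} {y v : EuclideanSpace ℝ (Fin m)}
    (hy : y ∈ range (QModel m)) (hv : ∀ l, y l = 0 → 0 ≤ v l) :
    v ∈ posTangentConeAt (range (QModel m)) y := by
  refine mem_posTangentConeAt_of_frequently_mem (Eventually.frequently ?_)
  rw [range_qModel] at hy ⊢
  refine eventually_all.2 fun l => ?_
  rcases (hy l).eq_or_lt with hyl | hyl
  · filter_upwards [self_mem_nhdsWithin] with t ht
    simpa [← hyl] using mul_nonneg (le_of_lt ht) (hv l hyl.symm)
  · have hcont : ContinuousAt (fun t : ℝ => (y + t • v) l) 0 := by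
      simp only [PiLp.add_apply, PiLp.smul_apply, smul_eq_mul]
      fun_prop
    filter_upwards [nhdsWithin_le_nhds (hcont.eventually_const_lt (by simpa using hyl))] with t ht
      using ht.le

variable {n : ℕ} {M : Type*} [TopologicalSpace M] [ChartedSpace (EuclideanQuadrant (n + 1)) M]
  [IsManifold (QModel (n + 1)) ∞ M] {e e' : OpenPartialHomeomorph M (EuclideanQuadrant (n + 1))}
  {i : Fin (n + 1)} {x : M}

-- Each coordinate of `e'` that vanishes at `x` is minimal there.
theorem dChart_nonneg (he : e ∈ atlas (EuclideanQuadrant (n + 1)) M)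
    (he' : e' ∈ atlas (EuclideanQuadrant (n + 1)) M) (hx : x ∈ e.source) (hx' : x ∈ e'.source)
    {v : TangentSpace (QModel (n + 1)) x} (hv : ∀ l, (e x).1 l = 0 → 0 ≤ dChart e x v l)
    {j : Fin (n + 1)} (hj : (e' x).1 j = 0) : 0 ≤ dChart e' x v j := by
  set φ := (QModel (n + 1)).extendCoordChange e e'
  set y := e.extend (QModel (n + 1)) x
  have hderiv : HasFDerivWithinAt (fun z => φ z j)
      ((EuclideanSpace.proj j : EuclideanSpace ℝ (Fin (n + 1)) →L[ℝ] ℝ).comp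
        (fderivWithin ℝ φ (range (QModel (n + 1))) y)) (range (QModel (n + 1))) y :=
    (EuclideanSpace.proj j : EuclideanSpace ℝ (Fin (n + 1)) →L[ℝ] ℝ).hasFDerivAt
      |>.comp_hasFDerivWithinAt y ((contDiffWithinAt_coordChange he he'
        (extend_mem_extendCoordChange_source hx hx')).differentiableWithinAt
          (by simp)).hasFDerivWithinAt
  have hφy : φ y j = 0 := by
    have hφ : φ y = (e' x).1 := congrArg (e'.extend (QModel (n + 1)))
      ((e.extend (QModel (n + 1))).left_inv (by rwa [e.extend_source]))
    rw [hφ, hj]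
  have hmin : IsLocalMinOn (fun z => φ z j) (range (QModel (n + 1))) y := by
    filter_upwards [self_mem_nhdsWithin] with z hz
    have hφz : φ z ∈ range (QModel (n + 1)) := extendCoordChange_mapsTo hz
    rw [range_qModel] at hφz
    exact hφy.trans_le (hφz j)
  refine (hmin.hasFDerivWithinAt_nonneg hderiv
    (mem_posTangentConeAt_range_qModel (mem_range_self _) hv)).trans_eq ?_
  exact congrArg (fun w : EuclideanSpace ℝ (Fin (n + 1)) => w j)
    (mfderiv_extend_coordChange he he' hx hx' v).symm

theorem IsFaceChart.dChart_nonneg (h : IsFaceChart e i x)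
    (he' : e' ∈ atlas (EuclideanQuadrant (n + 1)) M) (hx' : x ∈ e'.source)
    {v : TangentSpace (QModel (n + 1)) x} (hv : 0 ≤ dChart e x v i)
    {j : Fin (n + 1)} (hj : (e' x).1 j = 0) : 0 ≤ dChart e' x v j :=
  CornerStokes.dChart_nonneg h.mem_atlas he' h.mem_source hx'
    (fun l hl => (h.eq_zero_iff l).1 hl ▸ hv) hj

theorem IsFaceChart.eq_of_eq_zero {i₀ j : Fin (n + 1)} (h : IsFaceChart e i₀ x)
    (he' : e' ∈ atlas (EuclideanQuadrant (n + 1)) M) (hx' : x ∈ e'.source)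
    (hi : (e' x).1 i = 0) (hj : (e' x).1 j = 0) : i = j := by
  by_contra hne
  obtain ⟨v, hv⟩ := (dChart_bijective he' hx').2
    (EuclideanSpace.single i (1 : ℝ) - EuclideanSpace.single j 1)
  -- `v` or `-v` is inward in `e`, but neither is inward in `e'`.
  rcases le_total 0 (dChart e x v i₀) with hpos | hneg
  · have hvj := h.dChart_nonneg he' hx' hpos hj
    rw [hv] at hvj
    simp [Ne.symm hne] at hvj
    linarith
  · have hvi := h.dChart_nonneg he' hx' (v := -v) (by
      rw [map_neg]; exact neg_nonneg.2 hneg) hi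
    rw [map_neg, hv] at hvi
    simp [hne] at hvi
    linarith

theorem isFaceChart_of_mem_stratum (hx : x ∈ stratum (n + 1) M 1)
    (he : e ∈ atlas (EuclideanQuadrant (n + 1)) M) (hxe : x ∈ e.source) :
    ∃ i, IsFaceChart e i x := by
  obtain ⟨e₀, i₀, h₀⟩ := exists_isFaceChart hx
  obtain ⟨i, hi⟩ : ∃ i, (e x).1 i = 0 := by
    by_contra! h
    exact h 0 (eq_zero_of_mem_stratum hx he hxe fun j =>
      lt_of_le_of_ne ((e x).2 _) (h _).symm)
  exact ⟨i, he, hxe, fun j => ⟨fun hj => h₀.eq_of_eq_zero he hxe hj hi, fun hj => hj ▸ hi⟩⟩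

theorem IsOutward.dChart_neg {x : stratum (n + 1) M 1}
    {v : TangentSpace (QModel (n + 1)) (incl n M x)} (hv : IsOutward x v)
    (h : IsFaceChart e i (incl n M x)) : dChart e (incl n M x) v i < 0 := by
  obtain ⟨e', i', h', hneg⟩ := hv
  contrapose! hneg
  exact h.dChart_nonneg h'.mem_atlas h'.mem_source hneg ((h'.eq_zero_iff i').2 rfl)

end Corners

section FrameSign

theorem frameSign_rayOfNeZero {k : ℕ} {V : Type*} [AddCommGroup V] [Module ℝ V]
    {ψ : V [⋀^Fin k]→ₗ[ℝ] ℝ} (hψ : ψ ≠ 0) (w : Fin k → V) :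
    frameSign (rayOfNeZero ℝ ψ hψ) w = SignType.sign (ψ w) := by
  have hray : SameRay ℝ (Module.Ray.someVector (rayOfNeZero ℝ ψ hψ)) ψ :=
    (ray_eq_iff (Module.Ray.someVector_ne_zero _) hψ).1 (Module.Ray.someVector_ray _)
  obtain ⟨r₁, r₂, hr₁, hr₂, hr⟩ := hray.exists_pos (Module.Ray.someVector_ne_zero _) hψ
  simpa only [frameSign, AlternatingMap.smul_apply, smul_eq_mul, sign_mul, sign_pos hr₁,
    sign_pos hr₂, one_mul] using congrArg (fun T => SignType.sign (T w)) hr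

theorem frameSign_congr {k : ℕ} {H : Type*} [TopologicalSpace H]
    {I : ModelWithCorners ℝ (EuclideanSpace ℝ (Fin k)) H}
    {M : Type*} [TopologicalSpace M] [ChartedSpace H M] (o : PointwiseOrientation I M)
    {x x' : M} (hx : x = x') {w w' : Fin k → EuclideanSpace ℝ (Fin k)} (hw : w = w') :
    frameSign (o x) w = frameSign (o x') w' := by
  subst hx hw
  rfl

theorem eq_sum_smul_stdFrame {m : ℕ} (a : EuclideanSpace ℝ (Fin m)) :
    a = ∑ l, a l • stdFrame m l := by
  ext j
  simp [stdFrame, Pi.single_apply]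

theorem topForm_cons_face {n : ℕ} (Φ : EuclideanSpace ℝ (Fin (n + 1)) [⋀^Fin (n + 1)]→ₗ[ℝ] ℝ)
    (i : Fin (n + 1)) (a : EuclideanSpace ℝ (Fin (n + 1))) :
    Φ (Matrix.vecCons a fun j => faceIncl i (stdFrame n j)) =
      a i * ((-1) ^ i.val * Φ (stdFrame (n + 1))) := by
  rw [← removeNth_stdFrame]
  have hne : ∀ j : Fin n,
      Φ (Matrix.vecCons (stdFrame (n + 1) (i.succAbove j)) (i.removeNth (stdFrame (n + 1)))) = 0 :=
    fun j => Φ.map_eq_zero_of_eq _ (i := 0) (j := j.succ) rfl (Fin.succ_ne_zero j).symm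
  have heq : Φ (Matrix.vecCons (stdFrame (n + 1) i) (i.removeNth (stdFrame (n + 1)))) =
      (-1) ^ i.val * Φ (stdFrame (n + 1)) := by
    have hmove := Φ.neg_one_pow_smul_map_insertNth i (stdFrame (n + 1) i)
      (i.removeNth (stdFrame (n + 1)))
    rw [Fin.insertNth_self_removeNth] at hmove
    simp [← hmove]
  have hlin : Φ (Matrix.vecCons a (i.removeNth (stdFrame (n + 1)))) = ∑ l, a l *
      Φ (Matrix.vecCons (stdFrame (n + 1) l) (i.removeNth (stdFrame (n + 1)))) := by
    have hcons : ∀ b, Matrix.vecCons b (i.removeNth (stdFrame (n + 1))) =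
        Function.update (Matrix.vecCons 0 (i.removeNth (stdFrame (n + 1)))) 0 b :=
      fun b => (Fin.update_cons_zero _ _ _).symm
    conv_lhs => rw [eq_sum_smul_stdFrame a, hcons, Φ.map_update_sum]
    simp only [← hcons, Φ.map_vecCons_smul, smul_eq_mul]
  rw [hlin, Fin.sum_univ_succAbove _ i, heq]
  simp only [hne, mul_zero, Finset.sum_const_zero, add_zero]

end FrameSign

section FaceCharts

variable {n : ℕ} {M : Type*} [TopologicalSpace M] [ChartedSpace (EuclideanQuadrant (n + 1)) M]
  [IsManifold (QModel (n + 1)) ∞ M] {e : OpenPartialHomeomorph M (EuclideanQuadrant (n + 1))}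
  {i : Fin (n + 1)} {x₀ : stratum (n + 1) M 1} {he : e ∈ atlas (EuclideanQuadrant (n + 1)) M}
  {u : EuclideanSpace ℝ (Fin n)}

theorem faceChart_extend_target :
    ((faceChart e i x₀ he).extend (𝓡 n)).target = faceTarget e i := by
  rw [OpenPartialHomeomorph.extend_target]
  simp [faceChart]

theorem incl_faceChart_symm (hu : u ∈ faceTarget e i) :
    incl n M (((faceChart e i x₀ he).extend (𝓡 n)).symm u) =
      (e.extend (QModel (n + 1))).symm (faceIncl i u) :=
  faceChart_symm_val e i x₀ he hu

theorem isOpen_faceTarget (x₀ : stratum (n + 1) M 1)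
    (he : e ∈ atlas (EuclideanQuadrant (n + 1)) M) : IsOpen (faceTarget e i) :=
  (faceChart e i x₀ he).open_target

theorem dIncl_dChartSymm (hu : u ∈ faceTarget e i) (v : EuclideanSpace ℝ (Fin n)) :
    (dIncl (((faceChart e i x₀ he).extend (𝓡 n)).symm u)
      (dChartSymm (𝓡 n) (faceChart e i x₀ he) u v) : EuclideanSpace ℝ (Fin (n + 1))) =
      dChartSymm (QModel (n + 1)) e (faceIncl i u) (faceIncl i v) := by
  set c := faceChart e i x₀ he
  have hut : u ∈ (c.extend (𝓡 n)).target := by rwa [faceChart_extend_target]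
  have hnhds : faceTarget e i ∈ 𝓝 u := (isOpen_faceTarget x₀ he).mem_nhds hu
  have hboundary := ((contMDiff_incl (n := n) (M := M) _).mdifferentiableAt
    (by simp)).hasMFDerivAt.comp_hasMFDerivWithinAt u (mdifferentiableWithinAt_extend_symm
      (faceChart_mem_atlas e i x₀ he) hut).hasMFDerivWithinAt
  have hinterior := (mdifferentiableWithinAt_extend_symm he hu.2).hasMFDerivWithinAt.comp u
    ((faceIncl i).hasMFDerivAt.hasMFDerivWithinAt (s := faceTarget e i))
    fun z hz => e.extend_target_subset_range hz.2
  have heq : incl n M ∘ (c.extend (𝓡 n)).symm =ᶠ[𝓝 u]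
      (e.extend (QModel (n + 1))).symm ∘ faceIncl i := by
    filter_upwards [hnhds] with z hz using incl_faceChart_symm hz
  have hderiv := hasMFDerivAt_unique (hboundary.hasMFDerivAt (by simp))
    ((hinterior.hasMFDerivAt hnhds).congr_of_eventuallyEq heq)
  exact congrArg
    (fun T : EuclideanSpace ℝ (Fin n) →L[ℝ] EuclideanSpace ℝ (Fin (n + 1)) => T v) hderiv

theorem chartRep_pullback_incl {k : ℕ} (α : DiffForm (QModel (n + 1)) M k)
    (hu : u ∈ faceTarget e i) :
    chartRep (𝓡 n) (faceChart e i x₀ he) (pullback (QModel (n + 1)) (𝓡 n) (incl n M) α) u =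
      (chartRep (QModel (n + 1)) e α (faceIncl i u)).compContinuousLinearMap (faceIncl i) := by
  ext v
  exact α.apply_congr (incl_faceChart_symm hu) (funext fun j => dIncl_dChartSymm hu (v j))

theorem continuousForm_pullback_incl {k : ℕ} {α : DiffForm (QModel (n + 1)) M k}
    (hα : ContinuousForm α) :
    ContinuousForm (pullback (QModel (n + 1)) (𝓡 n) (incl n M) α) := by
  rintro _ ⟨e, i, x₀, he, rfl⟩
  rw [faceChart_extend_target]
  refine ContinuousOn.congr ?_ fun u hu => chartRep_pullback_incl α hu
  exact (ContinuousAlternatingMap.compContinuousLinearMapCLM (faceIncl i)).continuous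
    |>.comp_continuousOn
      ((hα e he).comp (faceIncl i).continuous.continuousOn fun u hu => hu.2)

theorem exists_isOutward_frameSign_boundaryOrientation
    (o : PointwiseOrientation (QModel (n + 1)) M) (x : stratum (n + 1) M 1) :
    ∃ ν, IsOutward x ν ∧ ∀ w : Fin n → TangentSpace (𝓡 n) x,
      frameSign (boundaryOrientation o x) w =
        frameSign (o (incl n M x)) (Matrix.vecCons ν fun j => dIncl x (w j)) := by
  refine ⟨_, (exists_isOutward x).choose_spec, fun w => (frameSign_rayOfNeZero _ _).trans ?_⟩
  refine congrArg (fun v => SignType.sign ((o (incl n M x)).someVector v)) (funext fun j => ?_)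
  exact Fin.cases rfl (fun _ => rfl) j

theorem frameSign_boundaryOrientation (o : PointwiseOrientation (QModel (n + 1)) M)
    (hu : u ∈ faceTarget e i) :
    frameSign (boundaryOrientation o (((faceChart e i x₀ he).extend (𝓡 n)).symm u))
        (fun j => dChartSymm (𝓡 n) (faceChart e i x₀ he) u (stdFrame n j)) =
      SignType.sign ((-1 : ℝ) ^ (i.val + 1)) *
        frameSign (o ((e.extend (QModel (n + 1))).symm (faceIncl i u)))
          (fun j => dChartSymm (QModel (n + 1)) e (faceIncl i u) (stdFrame (n + 1) j)) := by
  set x := ((faceChart e i x₀ he).extend (𝓡 n)).symm u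
  have hx : incl n M x = (e.extend (QModel (n + 1))).symm (faceIncl i u) := incl_faceChart_symm hu
  have hface : IsFaceChart e i (incl n M x) := hx ▸ isFaceChart_of_mem_faceTarget he hu
  obtain ⟨ν, hν, hsign⟩ := exists_isOutward_frameSign_boundaryOrientation o x
  set a : EuclideanSpace ℝ (Fin (n + 1)) := dChart e (incl n M x) ν
  let d := dChartSymm (QModel (n + 1)) e (faceIncl i u)
  have hda : (d a : EuclideanSpace ℝ (Fin (n + 1))) = ν := by
    refine (dChart_bijective he hface.mem_source).1 ?_
    have hself := mfderiv_extend_comp_dChartSymm_self he hu.2 a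
    rw [← hx] at hself
    exact hself
  have hframe : (Matrix.vecCons ν fun j => dIncl x
      (dChartSymm (𝓡 n) (faceChart e i x₀ he) u (stdFrame n j))) =
      fun j => d (Matrix.vecCons a (fun j => faceIncl i (stdFrame n j)) j) :=
    funext <| Fin.cases hda.symm fun j => dIncl_dChartSymm hu (stdFrame n j)
  rw [hsign, frameSign_congr o hx hframe, frameSign]
  have hcons := topForm_cons_face ((o ((e.extend (QModel (n + 1))).symm
    (faceIncl i u))).someVector.compLinearMap d.toLinearMap) i a
  refine (congrArg SignType.sign hcons).trans ?_
  rw [← mul_assoc, sign_mul, sign_mul, sign_neg (hν.dChart_neg hface), pow_succ', sign_mul,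
    sign_neg neg_one_lt_zero]
  rfl

theorem coe_sign_neg_one_pow (l : ℕ) :
    ((SignType.sign ((-1 : ℝ) ^ l) : SignType) : ℝ) = (-1) ^ l := by
  rcases neg_one_pow_eq_or ℝ l with h | h <;> simp [h]

theorem chartSign_boundaryOrientation (o : PointwiseOrientation (QModel (n + 1)) M)
    (hu : u ∈ faceTarget e i) :
    chartSign (boundaryOrientation o) (faceChart e i x₀ he) u =
      (-1) ^ (i.val + 1) * chartSign o e (faceIncl i u) := by
  rw [chartSign, frameSign_boundaryOrientation o hu, SignType.coe_mul, coe_sign_neg_one_pow]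
  rfl

theorem isOrientation_boundaryOrientation {o : PointwiseOrientation (QModel (n + 1)) M}
    (ho : IsOrientation (QModel (n + 1)) o) : IsOrientation (𝓡 n) (boundaryOrientation o) := by
  rintro _ ⟨e, i, x₀, he, rfl⟩ u hu
  rw [faceChart_extend_target] at hu ⊢
  have hface : Tendsto (faceIncl i) (𝓝[faceTarget e i] u)
      (𝓝[(e.extend (QModel (n + 1))).target] (faceIncl i u)) :=
    (faceIncl i).continuous.continuousWithinAt.tendsto_nhdsWithin fun z hz => hz.2
  filter_upwards [hface.eventually (ho e he _ hu.2), self_mem_nhdsWithin] with z hz hzt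
  rw [frameSign_boundaryOrientation o hu, frameSign_boundaryOrientation o hzt, hz]

end FaceCharts

section SignedRep

variable {k j : ℕ} {H : Type*} [TopologicalSpace H]
  {I : ModelWithCorners ℝ (EuclideanSpace ℝ (Fin k)) H} {M : Type*} [TopologicalSpace M]
  [ChartedSpace H M] {e : OpenPartialHomeomorph M H} {o : PointwiseOrientation I M}
  {α : DiffForm I M j} {y : EuclideanSpace ℝ (Fin k)}

/-- The form `α` in the chart `e`, multiplied by the sign of this chart and extended by zero to the
whole model space, so that integrals over `e` become integrals over the model space. -/
def signedRep (o : PointwiseOrientation I M) (α : DiffForm I M j) (e : OpenPartialHomeomorph M H)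
    (y : EuclideanSpace ℝ (Fin k)) : EuclideanSpace ℝ (Fin k) [⋀^Fin j]→L[ℝ] ℝ :=
  (e.extend I).target.indicator (fun y => chartSign o e y • chartRep I e α y) y

theorem signedRep_of_mem (hy : y ∈ (e.extend I).target) :
    signedRep o α e y = chartSign o e y • chartRep I e α y :=
  indicator_of_mem hy _

theorem signedRep_of_notMem (hy : y ∉ (e.extend I).target) : signedRep o α e y = 0 :=
  indicator_of_notMem hy _

theorem signedRep_eq_zero (hy : y ∉ e.extend I '' closure {x : M | α x ≠ 0}) :
    signedRep o α e y = 0 := by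
  by_cases hyt : y ∈ (e.extend I).target
  · rw [signedRep_of_mem hyt, chartRep_eq_zero, smul_zero]
    exact eq_zero_of_notMem_closure fun h => hy ⟨_, h, (e.extend I).right_inv hyt⟩
  · exact signedRep_of_notMem hyt

theorem isCompact_extend_image (hc : CompactlySupported I α)
    (hs : closure {x : M | α x ≠ 0} ⊆ e.source) :
    IsCompact (e.extend I '' closure {x : M | α x ≠ 0}) :=
  hc.image_of_continuousOn (e.continuousOn_extend.mono (by rwa [e.extend_source]))

theorem extend_image_subset_target (hs : closure {x : M | α x ≠ 0} ⊆ e.source) :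
    e.extend I '' closure {x : M | α x ≠ 0} ⊆ (e.extend I).target :=
  (image_mono hs).trans (by rw [← e.extend_source (I := I)]; exact (e.extend I).mapsTo.image_subset)

theorem signedRep_eventuallyEq (ho : IsOrientation I o) (he : e ∈ atlas H M)
    (hy : y ∈ (e.extend I).target) :
    signedRep o α e =ᶠ[𝓝[range I] y] fun z => chartSign o e y • chartRep I e α z := by
  have htarget := extend_target_mem_nhdsWithin_range hy
  filter_upwards [nhdsWithin_le_of_mem htarget (ho e he y hy), htarget] with z hz hzt
  rw [signedRep_of_mem hzt]
  simp only [chartSign, hz]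

theorem contDiffOn_signedRep (ho : IsOrientation I o) (hα : SmoothForm I α)
    (hc : CompactlySupported I α) (he : e ∈ atlas H M)
    (hs : closure {x : M | α x ≠ 0} ⊆ e.source) :
    ContDiffOn ℝ ∞ (signedRep o α e) (range I) := by
  intro y hy
  by_cases hyt : y ∈ (e.extend I).target
  · have hrep : ContDiffWithinAt ℝ ∞ (chartRep I e α) (range I) y :=
      (hα e he y hyt).mono_of_mem_nhdsWithin (extend_target_mem_nhdsWithin_range hyt)
    have heq := signedRep_eventuallyEq (α := α) ho he hyt
    exact (hrep.const_smul (chartSign o e y)).congr_of_eventuallyEq heq (heq.self_of_nhdsWithin hy)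
  · have hyK : y ∉ e.extend I '' closure {x : M | α x ≠ 0} :=
      fun h => hyt (extend_image_subset_target hs h)
    have hzero : signedRep o α e =ᶠ[𝓝 y] fun _ => 0 := by
      filter_upwards [(isCompact_extend_image hc hs).isClosed.isOpen_compl.mem_nhds hyK] with z hz
        using signedRep_eq_zero hz
    exact (contDiffAt_const.congr_of_eventuallyEq hzero).contDiffWithinAt

end SignedRep

theorem chartDensity_extDer {n : ℕ} {H : Type*} [TopologicalSpace H]
    {I : ModelWithCorners ℝ (EuclideanSpace ℝ (Fin (n + 1))) H} {M : Type*} [TopologicalSpace M]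
    [ChartedSpace H M] [IsManifold I ∞ M] {e : OpenPartialHomeomorph M H}
    {o : PointwiseOrientation I M} {α : DiffForm I M n} (ho : IsOrientation I o)
    (hα : SmoothForm I α) (he : e ∈ atlas H M) {y : EuclideanSpace ℝ (Fin (n + 1))}
    (hy : y ∈ (e.extend I).target) :
    chartDensity o (extDer I α) e y =
      extDerivWithin (signedRep o α e) (range I) y (stdFrame (n + 1)) := by
  have hyr := e.extend_target_subset_range hy
  rw [(signedRep_eventuallyEq ho he hy).extDerivWithin_eq_of_mem hyr,
    extDerivWithin_fun_smul _ _ (I.uniqueDiffOn y hyr), chartDensity, chartRep_extDer hα he hy]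
  rfl

section PartitionOfUnity

variable {E : Type*} [NormedAddCommGroup E] [NormedSpace ℝ E] {H : Type*} [TopologicalSpace H]
  {I : ModelWithCorners ℝ E H} {M : Type*} [TopologicalSpace M] [ChartedSpace H M] {k : ℕ}

theorem closure_smul_ne_zero_subset (ρ : M → ℝ) (α : DiffForm I M k) :
    closure {z : M | ρ z • α z ≠ 0} ⊆ tsupport ρ ∩ closure {z : M | α z ≠ 0} :=
  closure_minimal (fun _ hz => ⟨subset_tsupport _ (left_ne_zero_of_smul hz),
    subset_closure (right_ne_zero_of_smul hz)⟩) ((isClosed_tsupport _).inter isClosed_closure)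

theorem exists_eq_sum_of_support_subset_chart_source [FiniteDimensional ℝ E] [IsManifold I ∞ M]
    [T2Space M] [SecondCountableTopology M] {α : DiffForm I M k} (hα : SmoothForm I α)
    (hc : CompactlySupported I α) :
    ∃ (s : Finset M) (β : M → DiffForm I M k), (∀ x, SmoothForm I (β x)) ∧
      (∀ x, CompactlySupported I (β x)) ∧
      (∀ x, closure {z : M | β x z ≠ 0} ⊆ (chartAt H x).source) ∧ α = ∑ x ∈ s, β x := by
  have : LocallyCompactSpace H := I.locallyCompactSpace
  have : LocallyCompactSpace M := ChartedSpace.locallyCompactSpace H M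
  set K := closure {x : M | α x ≠ 0}
  obtain ⟨f, hf⟩ := SmoothPartitionOfUnity.exists_isSubordinate I
    (isClosed_closure (s := {x : M | α x ≠ 0})) (fun x : M => (chartAt H x).source)
    (fun x => (chartAt H x).open_source) fun x _ => mem_iUnion.2 ⟨x, mem_chart_source H x⟩
  have hfin : {x | (Function.support (f x) ∩ K).Nonempty}.Finite :=
    f.locallyFinite.finite_nonempty_inter_compact hc
  have hsupp := fun x => closure_smul_ne_zero_subset (f x) α
  refine ⟨hfin.toFinset, fun x z => f x z • α z, fun x => hα.smul (f x).contMDiff,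
    fun x => hc.of_isClosed_subset isClosed_closure ((hsupp x).trans inter_subset_right),
    fun x => (hsupp x).trans (inter_subset_left.trans (hf x)), ?_⟩
  funext z
  rw [Finset.sum_apply, ← Finset.sum_smul]
  by_cases hz : z ∈ K
  · have hone := f.sum_eq_one hz
    rw [finsum_eq_sum_of_support_subset (s := hfin.toFinset) _ fun x hx => by
      rw [Finite.coe_toFinset]; exact ⟨z, hx, hz⟩] at hone
    rw [hone, one_smul]
  · rw [eq_zero_of_notMem_closure hz, smul_zero]

end PartitionOfUnity

section Stokes

variable {n : ℕ} {M : Type*} [TopologicalSpace M] [ChartedSpace (EuclideanQuadrant (n + 1)) M]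
  {e : OpenPartialHomeomorph M (EuclideanQuadrant (n + 1))}
  {o : PointwiseOrientation (QModel (n + 1)) M}

theorem faceTarget_eq_empty [IsEmpty (stratum (n + 1) M 1)]
    (he : e ∈ atlas (EuclideanQuadrant (n + 1)) M) (i : Fin (n + 1)) : faceTarget e i = ∅ :=
  eq_empty_of_forall_notMem fun _ hu =>
    isEmptyElim (⟨_, (isFaceChart_of_mem_faceTarget he hu).mem_stratum⟩ : stratum (n + 1) M 1)

theorem setIntegral_faceTarget_signedRep (o : PointwiseOrientation (QModel (n + 1)) M) {k : ℕ}
    (α : DiffForm (QModel (n + 1)) M k) (i : Fin (n + 1))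
    (v : Fin k → EuclideanSpace ℝ (Fin (n + 1))) :
    ∫ u in faceTarget e i, signedRep o α e (faceIncl i u) v =
      ∫ u in range (QModel n), signedRep o α e (faceIncl i u) v := by
  rw [← setIntegral_congr_set (setOf_pos_ae_eq_range_qModel n)]
  refine (setIntegral_eq_of_subset_of_forall_sdiff_eq_zero ?_ (fun u hu => hu.1) ?_).symm
  · rw [← interior_range_qModel]
    exact isOpen_interior.measurableSet
  · rintro u ⟨hu, hut⟩
    rw [signedRep_of_notMem fun h => hut ⟨hu, h⟩]
    rfl

variable [IsManifold (QModel (n + 1)) ∞ M]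

theorem pullback_incl_eq_zero {k : ℕ} {α : DiffForm (QModel (n + 1)) M k}
    {x : stratum (n + 1) M 1} (h : α (incl n M x) = 0) :
    pullback (QModel (n + 1)) (𝓡 n) (incl n M) α x = 0 := by
  simp only [pullback, h]
  rfl

theorem pullback_incl_sum {k : ℕ} {ι : Type*} (s : Finset ι)
    (β : ι → DiffForm (QModel (n + 1)) M k) :
    pullback (QModel (n + 1)) (𝓡 n) (incl n M) (∑ x ∈ s, β x) =
      ∑ x ∈ s, pullback (QModel (n + 1)) (𝓡 n) (incl n M) (β x) := by
  funext x
  ext v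
  rw [Finset.sum_apply, ContinuousAlternatingMap.sum_apply]
  simp only [pullback, Finset.sum_apply]
  exact ContinuousAlternatingMap.sum_apply _ _

theorem disjoint_faceChart_source (x₀ : stratum (n + 1) M 1)
    (he : e ∈ atlas (EuclideanQuadrant (n + 1)) M) :
    Pairwise (Function.onFun Disjoint fun i => (faceChart e i x₀ he).source) := by
  intro i j hij
  rw [Function.onFun, disjoint_left]
  rintro x ⟨hx, hi⟩ ⟨-, hj⟩
  obtain ⟨l, hl⟩ := Fin.exists_succAbove_eq hij
  exact (hj l).ne' (hl ▸ eq_zero_of_mem_stratum x.2 he hx hi)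

theorem mem_iUnion_faceChart_source {x x₀ : stratum (n + 1) M 1}
    (he : e ∈ atlas (EuclideanQuadrant (n + 1)) M) (hx : incl n M x ∈ e.source) :
    x ∈ ⋃ i, (faceChart e i x₀ he).source := by
  obtain ⟨i, hi⟩ := isFaceChart_of_mem_stratum x.2 he hx
  exact mem_iUnion.2 ⟨i, hi.mem_faceChart_source⟩

variable {α : DiffForm (QModel (n + 1)) M n}

theorem chartDensity_pullback_incl {x₀ : stratum (n + 1) M 1}
    {he : e ∈ atlas (EuclideanQuadrant (n + 1)) M} {i : Fin (n + 1)}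
    {u : EuclideanSpace ℝ (Fin n)} (hu : u ∈ faceTarget e i) :
    chartDensity (boundaryOrientation o) (pullback (QModel (n + 1)) (𝓡 n) (incl n M) α)
        (faceChart e i x₀ he) u =
      (-1) ^ (i.val + 1) * signedRep o α e (faceIncl i u) fun j => faceIncl i (stdFrame n j) := by
  rw [chartDensity, chartSign_boundaryOrientation o hu, chartRep_pullback_incl α hu,
    signedRep_of_mem hu.2, mul_assoc]
  rfl

variable [MeasurableSpace M] [BorelSpace M] [SecondCountableTopology M]

theorem formIntegral_extDer_of_support_subset_source (ho : IsOrientation (QModel (n + 1)) o)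
    (hα : SmoothForm (QModel (n + 1)) α) (hc : CompactlySupported (QModel (n + 1)) α)
    (he : e ∈ atlas (EuclideanQuadrant (n + 1)) M)
    (hs : closure {x : M | α x ≠ 0} ⊆ e.source) :
    IntegrableForm (QModel (n + 1)) o (extDer (QModel (n + 1)) α) ∧
      formIntegral (QModel (n + 1)) o (extDer (QModel (n + 1)) α) =
        ∫ y in range (QModel (n + 1)),
          extDerivWithin (signedRep o α e) (range (QModel (n + 1))) y (stdFrame (n + 1)) := by
  have hK := isCompact_extend_image hc hs
  have hrep : ContDiffOn ℝ 1 (signedRep o α e) (range (QModel (n + 1))) :=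
    (contDiffOn_signedRep ho hα hc he hs).of_le (by simp)
  have hdensity : EqOn (fun y => extDerivWithin (signedRep o α e) (range (QModel (n + 1))) y
      (stdFrame (n + 1))) (chartDensity o (extDer (QModel (n + 1)) α) e)
      (e.extend (QModel (n + 1))).target := fun y hy => (chartDensity_extDer ho hα he hy).symm
  obtain ⟨hint, hsum⟩ := formIntegral_eq_sum_of_disjoint_sources (ι := Unit) (c := fun _ => e) ho
    (η := extDer (QModel (n + 1)) α) (fun _ => hα.continuousOn_chartRep_extDer) (fun _ => he)
    Subsingleton.pairwise
    (fun x hx => extDer_eq_zero fun h => hx (mem_iUnion.2 ⟨(), hs h⟩))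
    fun _ => ((integrableOn_extDerivWithin_qModel hrep hK (fun _ => signedRep_eq_zero) _).mono_set
      e.extend_target_subset_range).congr_fun hdensity measurableSet_extend_target
  refine ⟨hint, ?_⟩
  rw [hsum, Fintype.sum_unique, ← setIntegral_congr_fun measurableSet_extend_target hdensity]
  refine (setIntegral_eq_of_subset_of_forall_sdiff_eq_zero
    (QModel (n + 1)).isClosed_range.measurableSet e.extend_target_subset_range ?_).symm
  rintro y ⟨-, hy⟩
  rw [extDerivWithin_eq_zero_of_notMem hK.isClosed (fun _ => signedRep_eq_zero)
    fun h => hy (extend_image_subset_target hs h)]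
  rfl

theorem formIntegral_pullback_incl_of_support_subset_source
    (ho : IsOrientation (QModel (n + 1)) o) (hα : SmoothForm (QModel (n + 1)) α)
    (hc : CompactlySupported (QModel (n + 1)) α) (he : e ∈ atlas (EuclideanQuadrant (n + 1)) M)
    (hs : closure {x : M | α x ≠ 0} ⊆ e.source) :
    IntegrableForm (𝓡 n) (boundaryOrientation o)
        (pullback (QModel (n + 1)) (𝓡 n) (incl n M) α) ∧
      formIntegral (𝓡 n) (boundaryOrientation o)
          (pullback (QModel (n + 1)) (𝓡 n) (incl n M) α) =
        ∑ i : Fin (n + 1), (-1) ^ (i.val + 1) * ∫ u in range (QModel n),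
          signedRep o α e (faceIncl i u) fun j => faceIncl i (stdFrame n j) := by
  simp only [← setIntegral_faceTarget_signedRep, ← integral_const_mul]
  rcases isEmpty_or_nonempty (stratum (n + 1) M 1) with hempty | ⟨⟨x₀⟩⟩
  · simp only [faceTarget_eq_empty he, setIntegral_empty, Finset.sum_const_zero]
    exact ⟨integrableForm_of_isEmpty _ _, formIntegral_of_isEmpty _ _⟩
  have hmeas : ∀ i, MeasurableSet (faceTarget e i) :=
    fun i => (isOpen_faceTarget x₀ he).measurableSet
  have hdensity : ∀ i : Fin (n + 1), EqOn (fun u => (-1) ^ (i.val + 1) *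
      signedRep o α e (faceIncl i u) fun j => faceIncl i (stdFrame n j))
      (chartDensity (boundaryOrientation o) (pullback (QModel (n + 1)) (𝓡 n) (incl n M) α)
        (faceChart e i x₀ he)) (faceTarget e i) :=
    fun i u hu => (chartDensity_pullback_incl hu).symm
  have hface : ∀ i, faceTarget e i ⊆ range (QModel n) := fun i u hu => by
    rw [range_qModel]
    exact fun j => (hu.1 j).le
  have hcont := (contDiffOn_signedRep ho hα hc he hs).continuousOn
  obtain ⟨hint, hsum⟩ := formIntegral_eq_sum_of_disjoint_sources
    (c := fun i => faceChart e i x₀ he) (isOrientation_boundaryOrientation ho)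
    (η := pullback (QModel (n + 1)) (𝓡 n) (incl n M) α)
    (continuousForm_pullback_incl fun e' he' => (hα e' he').continuousOn)
    (fun i => faceChart_mem_atlas e i x₀ he) (disjoint_faceChart_source x₀ he)
    (fun x hx => pullback_incl_eq_zero (eq_zero_of_notMem_closure fun h =>
      hx (mem_iUnion_faceChart_source he (hs h))))
    fun i => by
      rw [faceChart_extend_target]
      exact IntegrableOn.congr_fun (((integrableOn_comp_faceIncl hcont
        (isCompact_extend_image hc hs) (fun _ => signedRep_eq_zero) i _).mono_set
          (hface i)).const_mul _) (hdensity i) (hmeas i)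
  refine ⟨hint, hsum.trans (Finset.sum_congr rfl fun i _ => ?_)⟩
  rw [faceChart_extend_target, ← setIntegral_congr_fun (hmeas i) (hdensity i)]

theorem stokes_of_support_subset_source (ho : IsOrientation (QModel (n + 1)) o)
    (hα : SmoothForm (QModel (n + 1)) α) (hc : CompactlySupported (QModel (n + 1)) α)
    (he : e ∈ atlas (EuclideanQuadrant (n + 1)) M)
    (hs : closure {x : M | α x ≠ 0} ⊆ e.source) :
    IntegrableForm (QModel (n + 1)) o (extDer (QModel (n + 1)) α) ∧
      IntegrableForm (𝓡 n) (boundaryOrientation o)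
        (pullback (QModel (n + 1)) (𝓡 n) (incl n M) α) ∧
      formIntegral (QModel (n + 1)) o (extDer (QModel (n + 1)) α) =
        formIntegral (𝓡 n) (boundaryOrientation o)
          (pullback (QModel (n + 1)) (𝓡 n) (incl n M) α) := by
  obtain ⟨hint, hinterior⟩ := formIntegral_extDer_of_support_subset_source ho hα hc he hs
  obtain ⟨hint', hboundary⟩ := formIntegral_pullback_incl_of_support_subset_source ho hα hc he hs
  refine ⟨hint, hint', ?_⟩
  rw [hinterior, hboundary]
  exact stokes_quadrant ((contDiffOn_signedRep ho hα hc he hs).of_le (by simp))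
    (isCompact_extend_image hc hs) fun _ => signedRep_eq_zero

end Stokes

end CornerStokes
end

theorem proposition3p5_general (n : ℕ) (M : Type*) [TopologicalSpace M] [T2Space M]
    [SecondCountableTopology M] [MeasurableSpace M] [BorelSpace M]
    [ChartedSpace (EuclideanQuadrant (n + 1)) M]
    [IsManifold (CornerStokes.QModel (n + 1)) ∞ M]
    (o : CornerStokes.PointwiseOrientation (CornerStokes.QModel (n + 1)) M)
    (ho : CornerStokes.IsOrientation (CornerStokes.QModel (n + 1)) o)
    (α : CornerStokes.DiffForm (CornerStokes.QModel (n + 1)) M n)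
    (hα : CornerStokes.SmoothForm (CornerStokes.QModel (n + 1)) α)
    (hc : CornerStokes.CompactlySupported (CornerStokes.QModel (n + 1)) α) :
    CornerStokes.IntegrableForm (CornerStokes.QModel (n + 1)) o
        (CornerStokes.extDer (CornerStokes.QModel (n + 1)) α) ∧
      CornerStokes.IntegrableForm (𝓡 n) (CornerStokes.boundaryOrientation o)
        (CornerStokes.pullback (CornerStokes.QModel (n + 1)) (𝓡 n) (CornerStokes.incl n M) α) ∧
      CornerStokes.formIntegral (CornerStokes.QModel (n + 1)) o
          (CornerStokes.extDer (CornerStokes.QModel (n + 1)) α) =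
        CornerStokes.formIntegral (𝓡 n) (CornerStokes.boundaryOrientation o)
          (CornerStokes.pullback (CornerStokes.QModel (n + 1)) (𝓡 n)
            (CornerStokes.incl n M) α) := by
  obtain ⟨s, β, hβ, hβc, hβs, rfl⟩ :=
    CornerStokes.exists_eq_sum_of_support_subset_chart_source hα hc
  have stokes := fun x => CornerStokes.stokes_of_support_subset_source ho (hβ x) (hβc x)
    (chart_mem_atlas _ x) (hβs x)
  have extDer_continuous : ∀ x ∈ s, CornerStokes.ContinuousForm
      (CornerStokes.extDer (CornerStokes.QModel (n + 1)) (β x)) :=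
    fun x _ e he => (hβ x).continuousOn_chartRep_extDer he
  have pullback_continuous : ∀ x ∈ s, CornerStokes.ContinuousForm (CornerStokes.pullback
      (CornerStokes.QModel (n + 1)) (𝓡 n) (CornerStokes.incl n M) (β x)) :=
    fun x _ => CornerStokes.continuousForm_pullback_incl fun e he => (hβ x e he).continuousOn
  have ho' := CornerStokes.isOrientation_boundaryOrientation ho
  rw [CornerStokes.extDer_sum s fun x _ => hβ x, CornerStokes.pullback_incl_sum]
  refine ⟨CornerStokes.integrableForm_sum ho extDer_continuous fun x _ => (stokes x).1,
    CornerStokes.integrableForm_sum ho' pullback_continuous fun x _ => (stokes x).2.1, ?_⟩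
  rw [CornerStokes.formIntegral_sum ho extDer_continuous fun x _ => (stokes x).1,
    CornerStokes.formIntegral_sum ho' pullback_continuous fun x _ => (stokes x).2.1]
  exact Finset.sum_congr rfl fun x _ => (stokes x).2.2

theorem proposition3p5 (n : ℕ) (M : Type*) [TopologicalSpace M] [T2Space M]
    [SecondCountableTopology M] [ConnectedSpace M] [MeasurableSpace M] [BorelSpace M]
    [ChartedSpace (EuclideanQuadrant (n + 1)) M]
    [IsManifold (CornerStokes.QModel (n + 1)) ∞ M]
    (o : CornerStokes.PointwiseOrientation (CornerStokes.QModel (n + 1)) M)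
    (ho : CornerStokes.IsOrientation (CornerStokes.QModel (n + 1)) o)
    (α : CornerStokes.DiffForm (CornerStokes.QModel (n + 1)) M n)
    (hα : CornerStokes.SmoothForm (CornerStokes.QModel (n + 1)) α)
    (hc : CornerStokes.CompactlySupported (CornerStokes.QModel (n + 1)) α) :
    CornerStokes.IntegrableForm (CornerStokes.QModel (n + 1)) o
        (CornerStokes.extDer (CornerStokes.QModel (n + 1)) α) ∧
      CornerStokes.IntegrableForm (𝓡 n) (CornerStokes.boundaryOrientation o)
        (CornerStokes.pullback (CornerStokes.QModel (n + 1)) (𝓡 n) (CornerStokes.incl n M) α) ∧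
      CornerStokes.formIntegral (CornerStokes.QModel (n + 1)) o
          (CornerStokes.extDer (CornerStokes.QModel (n + 1)) α) =
        CornerStokes.formIntegral (𝓡 n) (CornerStokes.boundaryOrientation o)
          (CornerStokes.pullback (CornerStokes.QModel (n + 1)) (𝓡 n)
            (CornerStokes.incl n M) α) :=
  proposition3p5_general n M o ho α hα hc
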